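/- Lemma A.1. Let $d_1,d_2\ge 0$ be integers, $T>0$, $x_0\in\mathbb R^{d_1}$, let $g:\mathbb R^{d_1}\times\mathbb R^{d_2}\to\mathbb R^{d_1}$, let $\rho_x(y,dz)$, $x\in\mathbb R^{d_1}$, be transition kernels (probability kernels) on $\mathbb R^{d_2}$, and let $(\varepsilon_k)$ be a sequence of reals. Write $\rho_x^{(i)}$ for the $i$-step kernel, $t_n=\sum_{k=1}^n\varepsilon_k$, $\mathbf m(t)=\max\{n:t_n\le t\}$, $\beta_n=\mathbf m(t_n+T)-n$, and $h^n(t)=\beta_n\,\varepsilon_{\mathbf m(t_n+t)}$ for $t\in[0,T]$ (that is, $h^n(t)=\beta_n\varepsilon_{n+i-1}$ for $t\in[t_{n+i-1}-t_n,t_{n+i}-t_n)$). Assume: (A.1) $g$ is measurable, and for every $z$ the map $x\mapsto g(x,z)$ is Lipschitz continuous. (A.2) $\rho_x(y,dz)=\eta_x(y,z)\lambda(dz)$ for a probability measure $\lambda$ on $\mathbb R^{d_2}$ and a density $\eta\ge 0$; $x\mapsto\eta_x(y,z)$ is continuous, uniformly in $(y,z)$; and for every $x$ the map $(y,z)\mapsto\eta_x(y,z)$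 is continuous. (A.3) $\Lambda(x,\alpha,y)=\log\int e^{\langle\alpha,g(x,z)\rangle}\rho_x(y,dz)$ is continuous in $(x,\alpha)\in\mathbb R^{d_1}\times\mathbb R^{d_1}$, uniformly in $y$. (A.4) For every compact $K\subset\mathbb R^{d_1}$ there is a constant $C(K)$ with $\eta_x(y,z)\le C(K)\,\eta_w(y,z)$ for all $x,w\in K$ and all $y,z$. (A.5) For every $x$ there are positive integers $l_0,n_0$ such that $\sum_{i\ge l_0}2^{-i}\rho_x^{(i)}(y,\cdot)\ll\sum_{j\ge n_0}2^{-j}\rho_x^{(j)}(w,\cdot)$ for all $y,w$. (A.6) $\sup_{x}\sup_{y}\log\int e^{\langle\alpha,g(x,z)\rangle}\rho_x(y,dz)<\infty$ for every $\alpha\in\mathbb R^{d_1}$, and $\sup_{x}\sup_{y}\log\int e^{\langle\alpha,z\rangle}\rho_x(y,dz)<\infty$ for every $\alpha\in\mathbb R^{d_2}$. (A.7) $\varepsilon_k>0$ for $k\ge1$, $\varepsilon_k\to0$, $\sum_k\varepsilon_k=\infty$, and $h^n$ converges uniformly on $[0,T]$ to a limit $h$. For $x,\beta\in\mathbb R^{d_1}$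 put $$L(x,\beta)=\inf_{\mu}\Big\{\inf_{\gamma\in\mathcal A(\mu)}R(\gamma\,\|\,\mu\otimes\rho_x)\;:\;\beta=\int g(x,z)\,\mu(dz)\Big\}\in[0,\infty],$$ where $\mu$ ranges over the probability measures on $\mathbb R^{d_2}$ for which $g(x,\cdot)$ is integrable, $\mathcal A(\mu)$ is the set of probability measures on $\mathbb R^{d_2}\times\mathbb R^{d_2}$ with both marginals equal to $\mu$, $\mu\otimes\rho_x(dy\,dz)=\mu(dy)\rho_x(y,dz)$, $R$ is the relative entropy, and $\inf\emptyset=\infty$. Define $I:C([0,T]:\mathbb R^{d_1})\to[0,\infty]$ by $$I(\varphi)=\int_0^T\frac1{h(t)}L(\varphi(t),\dot\varphi(t))\,dt$$ if $\varphi$ is absolutely continuous with $\varphi(0)=x_0$, and $I(\varphi)=\infty$ otherwise. Then $I$ is a rate function: it is lower semicontinuous for the topology of uniform convergence, and for every $K<\infty$ the level set $\{\varphi:I(\varphi)\le K\}$ is compact. -/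

import Mathlib

open MeasureTheory ProbabilityTheory Set Filter Topology
open scoped ENNReal NNReal

noncomputable section

namespace StochApprox

/-- Euclidean space `ℝ^d`. -/
abbrev Euc (d : ℕ) : Type := EuclideanSpace ℝ (Fin d)

/-! ### Step sizes and the time scale -/

/-- The times `t_n = ε_1 + ⋯ + ε_n`, `t_0 = 0`. -/
def stepTime (ε : ℕ → ℝ) (n : ℕ) : ℝ := ∑ k ∈ Finset.Icc 1 n, ε k

/-- `m(t) = max {n : t_n ≤ t}`, for `t ≥ 0`. The set is nonempty for `t ≥ 0`, and it is bounded when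
`t_n → ∞`, so that the supremum in `ℕ` is the maximum. -/
def stepIndex (ε : ℕ → ℝ) (t : ℝ) : ℕ := sSup {n : ℕ | stepTime ε n ≤ t}

/-- `β_n = m(t_n + T) - n`, the number of steps made in the time window `[t_n, t_n + T]`. -/
def numSteps (ε : ℕ → ℝ) (T : ℝ) (n : ℕ) : ℕ := stepIndex ε (stepTime ε n + T) - n

/-- The function `h^n` on `[0, T]`. For `t ∈ [t_{n+i-1} - t_n, t_{n+i} - t_n)` one has
`m(t_n + t) = n + i - 1`, so the value is `β_n ε_{n+i-1}`. The same formula is used on the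
remaining short interval `[t_{n+β_n} - t_n, T]`, where the value is `β_n ε_{n+β_n}`. -/
def stepRate (ε : ℕ → ℝ) (T : ℝ) (n : ℕ) (t : ℝ) : ℝ :=
  (numSteps ε T n : ℝ) * ε (stepIndex ε (stepTime ε n + t))

/-! ### The assumption -/

/-- `log ∫ exp (f z) μ(dz)`, with values in the extended reals. -/
def logMGF {α : Type*} [MeasurableSpace α] (μ : Measure α) (f : α → ℝ) : EReal :=
  ENNReal.log (∫⁻ z, ENNReal.ofReal (Real.exp (f z)) ∂μ)

/-- The measure `∑_{i ≥ l} 2^{-i} κ^{(i)}(y, ·)`, where `κ^{(i)}` is the `i`-step transition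
kernel. -/
def discountedSteps {α : Type*} [MeasurableSpace α] (κ : Kernel α α) (l : ℕ) (y : α) :
    Measure α :=
  Measure.sum fun i : ℕ => ((2 : ℝ≥0∞)⁻¹ ^ (l + i)) • (κ ^ (l + i)) y

/-- The standing assumption on the data of the stochastic approximation
`X_{k+1} = X_k + ε_{k+1} g(X_k, Y_{k+1})`, where the conditional law of `Y_{k+1}` given
`(X_k, Y_k) = (x, y)` is `ρ x y`: here `lam` is the reference measure, `η x y z` is the density of
`ρ x y` at `z`, and `h` is the limiting time scale. -/
structure Assumptions {d₁ d₂ : ℕ} (g : Euc d₁ → Euc d₂ → Euc d₁)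
    (ρ : Euc d₁ → Kernel (Euc d₂) (Euc d₂)) (lam : Measure (Euc d₂))
    (η : Euc d₁ → Euc d₂ → Euc d₂ → ℝ) (ε : ℕ → ℝ) (T : ℝ) (h : ℝ → ℝ) : Prop where
  /-- `g` is measurable. -/
  measurable_g : Measurable (Function.uncurry g)
  /-- For every `z` the map `x ↦ g(x, z)` is Lipschitz; the constant may depend on `z`. -/
  lipschitz_g : ∀ z, ∃ K : ℝ≥0, LipschitzWith K fun x => g x z
  /-- Each `ρ_x(y, ·)` is a probability measure. -/
  isMarkovKernel : ∀ x, IsMarkovKernel (ρ x)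
  /-- The reference measure is a probability measure. -/
  isProbabilityMeasure : IsProbabilityMeasure lam
  /-- Densities are nonnegative. -/
  density_nonneg : ∀ x y z, 0 ≤ η x y z
  /-- `ρ_x(y, dz) = η_x(y, z) lam(dz)`. -/
  kernel_eq : ∀ x y, ρ x y = lam.withDensity fun z => ENNReal.ofReal (η x y z)
  /-- `x ↦ η_x(y, z)` is continuous, uniformly in `(y, z)`. -/
  density_equicontinuous :
    Equicontinuous fun (p : Euc d₂ × Euc d₂) (x : Euc d₁) => η x p.1 p.2
  /-- For every `x`, `(y, z) ↦ η_x(y, z)` is continuous. -/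
  density_continuous : ∀ x, Continuous fun p : Euc d₂ × Euc d₂ => η x p.1 p.2
  /-- `Λ(x, α, y) = log ∫ exp ⟨α, g(x, z)⟩ ρ_x(y, dz)` is continuous in `(x, α)`, uniformly in `y`
  (by `exp_moments_g` below this logarithm is a real number). -/
  logMGF_equicontinuous :
    Equicontinuous fun (y : Euc d₂) (p : Euc d₁ × Euc d₁) =>
      (logMGF (ρ p.1 y) fun z => inner ℝ p.2 (g p.1 z)).toReal
  /-- On every compact `K` the ratios `η_x(y, z) / η_w(y, z)`, `x, w ∈ K`, are bounded uniformly in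
  `(y, z)`, where `0 / 0` imposes no condition and `a / 0 = ∞` for `a > 0`. -/
  density_ratio : ∀ K : Set (Euc d₁), IsCompact K →
    ∃ C : ℝ, ∀ y z, ∀ x ∈ K, ∀ w ∈ K, η x y z ≤ C * η w y z
  /-- The transitivity condition. -/
  transitive : ∀ x, ∃ l₀ n₀ : ℕ, 0 < l₀ ∧ 0 < n₀ ∧ ∀ y w,
    discountedSteps (ρ x) l₀ y ≪ discountedSteps (ρ x) n₀ w
  /-- Uniform exponential moments of `g(x, ·)`. -/
  exp_moments_g : ∀ α : Euc d₁, (⨆ x, ⨆ y, logMGF (ρ x y) fun z => inner ℝ α (g x z)) < ⊤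
  /-- Uniform exponential moments of the noise. -/
  exp_moments_noise : ∀ α : Euc d₂, (⨆ x, ⨆ y, logMGF (ρ x y) fun z => inner ℝ α z) < ⊤
  /-- The step sizes are positive. -/
  step_pos : ∀ k, 1 ≤ k → 0 < ε k
  /-- The step sizes tend to zero. -/
  step_tendsto : Tendsto ε atTop (𝓝 0)
  /-- The step sizes sum to infinity. -/
  step_sum : Tendsto (stepTime ε) atTop atTop
  /-- `h^n` converges to `h` uniformly on `[0, T]`. -/
  stepRate_tendsto : TendstoUniformlyOn (stepRate ε T) h atTop (Icc 0 T)

/-! ### The rate function -/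

/-- `𝒜(μ)`: the probability measures on the product whose two marginals are both `μ`. -/
def couplings {α : Type*} [MeasurableSpace α] (μ : Measure α) : Set (Measure (α × α)) :=
  {γ | IsProbabilityMeasure γ ∧ γ.fst = μ ∧ γ.snd = μ}

/-- The local rate function
`L(x, β) = inf_μ { inf_{γ ∈ 𝒜(μ)} R(γ ‖ μ ⊗ ρ_x) : β = ∫ g(x, z) μ(dz) }`, the infimum being over
the probability measures `μ` for which `g(x, ·)` is integrable. For probability measures
`InformationTheory.klDiv` is the relative entropy `R`. -/
def localRate {d₁ d₂ : ℕ} (g : Euc d₁ → Euc d₂ → Euc d₁)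
    (ρ : Euc d₁ → Kernel (Euc d₂) (Euc d₂)) (x β : Euc d₁) : ℝ≥0∞ :=
  ⨅ (μ : Measure (Euc d₂)) (_ : IsProbabilityMeasure μ) (_ : Integrable (g x) μ)
    (_ : β = ∫ z, g x z ∂μ), ⨅ γ ∈ couplings μ, InformationTheory.klDiv γ (μ ⊗ₘ ρ x)

open scoped Classical in
/-- The functional `I` on `C([0, T] : ℝ^{d₁})`: it is `∫_0^T L(φ(t), φ'(t)) / h(t) dt` if `φ` is
absolutely continuous and starts at `x₀`, and `∞` otherwise. The path is extended to `ℝ` by constants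
outside `[0, T]`, which does not affect the derivative inside the interval. -/
def rateFn {d₁ d₂ : ℕ} (g : Euc d₁ → Euc d₂ → Euc d₁)
    (ρ : Euc d₁ → Kernel (Euc d₂) (Euc d₂)) (h : ℝ → ℝ) {T : ℝ} (hT : 0 < T) (x₀ : Euc d₁)
    (φ : C(Icc (0 : ℝ) T, Euc d₁)) : ℝ≥0∞ :=
  if AbsolutelyContinuousOnInterval (IccExtend hT.le φ) 0 T ∧ IccExtend hT.le φ 0 = x₀ then
    ∫⁻ t in Icc 0 T,
      localRate g ρ (IccExtend hT.le φ t) (deriv (IccExtend hT.le φ) t) / ENNReal.ofReal (h t)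
  else ⊤

/-- `I : 𝒳 → [0, ∞]` is a rate function: it is lower semicontinuous and its sublevel sets
`{I ≤ K}`, `K < ∞`, are compact. -/
def IsRateFunction {𝒳 : Type*} [TopologicalSpace 𝒳] (I : 𝒳 → ℝ≥0∞) : Prop :=
  LowerSemicontinuous I ∧ ∀ K : ℝ≥0, IsCompact {φ | I φ ≤ K}

end StochApprox

end

/-!
The functional `I` is an action `∫ L(φ, φ') / h`, and the theorem is Tonelli's: an integrand `L ≥ 0`
that is jointly lower semicontinuous, convex in the velocity, and superlinear in the velocity
uniformly in the state gives compact sublevel sets (`isCompact_setOf_actionFn_le`). Compact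
sublevel sets in a Hausdorff space are closed, which is lower semicontinuity. About the weight only
measurability and an upper bound for `h` are needed; both are inherited from the step functions
`h^n`. Where `h ≤ 0` the weight is `∞`, which is covered as well.

Tonelli's theorem. Superlinear growth makes the derivatives of paths of bounded action uniformly
integrable (`exists_uniform_setLIntegral_enorm_le`). Hence such paths are equicontinuous, uniform
limits of them are absolutely continuous, and their derivatives converge weakly in `L¹`
(`tendsto_setIntegral_deriv`). The integrand is the supremum of countably many affine functions of
the velocity, each localised to a ball of states (`exists_countable_localAffine`). For a single such
function the lower bound `∫_A f ≤ liminf ∫_A L` is weak convergence. As it holds for all measurable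
sets `A`, it passes to countable suprema (`setLIntegral_iSup_le_liminf`) and then to weighted
integrals (`lintegral_mul_le_liminf`).

The local rate `L`. Everything rests on the dual inequality `∫ ψ dπ ≤ K + ∫ (exp ψ - 1) dν` for
bounded continuous `ψ`, which characterises the bound `K` for the entropy of `π` relative to `ν`
(`integral_le_klDiv_add`, `klDiv_le_of_forall_boundedContinuous`). It yields the joint convexity of
the entropy and so the convexity of `L(x, ·)` (`localRate_convex`); with the exponential moments of
`g` it yields superlinear growth (`localRate_superlinear`). For lower semicontinuity
(`lowerSemicontinuous_localRate`), `g(x, ·)` is only measurable, so couplings cannot be passed to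
the limit directly. Instead the law of `((x, y), (z, g(x, z)))` is considered. The kernel
`(x, y) ↦ law of (z, g(x, z))` is Feller (`continuous_dualTerm`), because densities that converge
pointwise to a density converge in `L¹` and `x ↦ g(x, z)` is continuous. So the dual inequality
survives weak limits; and a law that satisfies it is absolutely continuous with respect to a measure
on the graph `w = g(x, z)`, hence lives on this graph (`klDiv_le_of_dual`). Exponential moments of
`z` and `g` give tightness and the convergence of the means.
-/

namespace StochApprox

/-! ### Affine minorants of a convex integrand -/

section AffineMinorants

variable {E : Type*} [NormedAddCommGroup E] [NormedSpace ℝ E]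

/-- A convex lower semicontinuous function with values in `[0, ∞]` is the supremum of the
positive parts of its continuous affine minorants: the epigraph is closed and convex, and a
hyperplane separates it from any point below the graph. -/
theorem exists_affine_minorant {f : E → ℝ≥0∞} (hf : LowerSemicontinuous f)
    (hconv : ∀ (u v : E) (a b : ℝ≥0), a + b = 1 → f (a • u + b • v) ≤ a * f u + b * f v)
    {u₀ : E} {c : ℝ} (hc0 : 0 ≤ c) (hc : ENNReal.ofReal c < f u₀) :
    ∃ (l : E →L[ℝ] ℝ) (r : ℝ), (∀ u, ENNReal.ofReal (l u + r) ≤ f u) ∧ c < l u₀ + r := by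
  set A : Set (E × ℝ) := {p | 0 ≤ p.2 ∧ f p.1 ≤ ENNReal.ofReal p.2} with hA
  have hAconv : Convex ℝ A := by
    rintro ⟨u, s⟩ ⟨hs, hu⟩ ⟨v, t⟩ ⟨ht, hv⟩ a b ha hb hab
    lift a to ℝ≥0 using ha
    lift b to ℝ≥0 using hb
    simp only [] at hs hu ht hv
    refine ⟨by simp only [Prod.smul_mk, Prod.mk_add_mk, smul_eq_mul]; positivity, ?_⟩
    simp only [Prod.smul_mk, Prod.mk_add_mk, smul_eq_mul]
    refine (hconv u v a b (by exact_mod_cast hab)).trans ?_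
    rw [ENNReal.ofReal_add (by positivity) (by positivity), ENNReal.ofReal_mul (by positivity),
      ENNReal.ofReal_mul (by positivity), ENNReal.ofReal_coe_nnreal, ENNReal.ofReal_coe_nnreal]
    gcongr
  have hAcl : IsClosed A := by
    have h1 : LowerSemicontinuous fun p : E × ℝ => f p.1 := hf.comp continuous_fst
    have h2 : Continuous fun p : E × ℝ => ENNReal.ofReal p.2 :=
      ENNReal.continuous_ofReal.comp continuous_snd
    have h3 : IsClosed {p : E × ℝ | f p.1 ≤ ENNReal.ofReal p.2} := by
      rw [← isOpen_compl_iff, isOpen_iff_mem_nhds]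
      intro p hp
      have hp' : ENNReal.ofReal p.2 < f p.1 := by simpa using hp
      obtain ⟨v, hv1, hv2⟩ := exists_between hp'
      filter_upwards [h1 p v hv2, h2.continuousAt.eventually_lt_const hv1] with q hq1 hq2
      simpa using hq2.trans hq1
    exact (isClosed_le continuous_const continuous_snd).inter h3
  have hnot : (u₀, c) ∉ A := fun h => absurd h.2 (not_le.2 hc)
  obtain ⟨F, w, hF1, hF2⟩ := geometric_hahn_banach_point_closed hAconv hAcl hnot
  have hsplit : ∀ u s, F (u, s) = F (u, 0) + s * F (0, 1) := by
    intro u s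
    have : ((u, s) : E × ℝ) = (u, 0) + s • ((0, 1) : E × ℝ) := by simp
    rw [this, map_add, map_smul, smul_eq_mul]
  set k := F (0, 1) with hk
  let l₀ : E →L[ℝ] ℝ := F.comp (ContinuousLinearMap.inl ℝ E ℝ)
  have hl₀ : ∀ u, l₀ u = F (u, 0) := fun u => rfl
  by_cases hdom : ∃ u, f u ≠ ⊤
  swap
  · push Not at hdom
    exact ⟨0, c + 1, fun u => by simp [hdom u], by simp⟩
  have key : ∀ u, f u ≠ ⊤ → ∀ s, (f u).toReal ≤ s → w < l₀ u + s * k := by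
    intro u hu s hs
    have := hF2 (u, s) ⟨ENNReal.toReal_nonneg.trans hs, by
      rw [← ENNReal.ofReal_toReal hu]; exact ENNReal.ofReal_le_ofReal hs⟩
    rwa [hsplit] at this
  rw [hsplit, ← hl₀] at hF1
  have hk0 : 0 ≤ k := by
    obtain ⟨u, hu⟩ := hdom
    by_contra hneg
    push Not at hneg
    have h1 := key u hu (max (f u).toReal ((w - l₀ u) / k)) (le_max_left _ _)
    have h2 : (w - l₀ u) / k ≤ max (f u).toReal ((w - l₀ u) / k) := le_max_right _ _
    rw [div_le_iff_of_neg hneg] at h2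
    linarith
  rcases hk0.eq_or_lt with hk0 | hk0
  · -- vertical hyperplane: since `0 ≤ f`, a large multiple of it is still a minorant
    rw [← hk0] at hF1 key
    simp only [mul_zero, add_zero] at hF1 key
    have hd : 0 < w - l₀ u₀ := by linarith
    refine ⟨-(((c + 1) / (w - l₀ u₀)) • l₀), ((c + 1) / (w - l₀ u₀)) * w, fun u => ?_, ?_⟩
    · by_cases hu : f u = ⊤
      · simp [hu]
      · have h1 := key u hu _ le_rfl
        rw [ENNReal.ofReal_of_nonpos]
        · exact zero_le
        · have h2 : 0 ≤ (c + 1) / (w - l₀ u₀) := by positivity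
          simp only [neg_apply, smul_apply, smul_eq_mul]
          nlinarith
    · simp only [neg_apply, smul_apply, smul_eq_mul]
      have : (c + 1) / (w - l₀ u₀) * (w - l₀ u₀) = c + 1 := div_mul_cancel₀ _ hd.ne'
      linarith
  · refine ⟨-(k⁻¹ • l₀), k⁻¹ * w, fun u => ?_, ?_⟩
    · by_cases hu : f u = ⊤
      · simp [hu]
      · have h1 := key u hu _ le_rfl
        rw [ENNReal.ofReal_le_iff_le_toReal hu]
        simp only [neg_apply, smul_apply, smul_eq_mul]
        have : -(k⁻¹ * l₀ u) + k⁻¹ * w = (w - l₀ u) / k := by field_simp; ring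
        rw [this, div_le_iff₀ hk0]
        linarith
    · simp only [neg_apply, smul_apply, smul_eq_mul]
      have : -(k⁻¹ * l₀ u₀) + k⁻¹ * w = (w - l₀ u₀) / k := by field_simp; ring
      rw [this, lt_div_iff₀ hk0]
      linarith

/-- The affine function `u ↦ l u + r`, cut off at zero and switched on only for `x` in the ball
of radius `δ` about `y`. -/
noncomputable def localAffine (y : E) (δ : ℝ) (l : E →L[ℝ] ℝ) (r : ℝ) (p : E × E) : ℝ≥0∞ :=
  (Metric.ball y δ).indicator (fun _ => ENNReal.ofReal (l p.2 + r)) p.1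

theorem lowerSemicontinuous_localAffine (y : E) (δ : ℝ) (l : E →L[ℝ] ℝ) (r : ℝ) :
    LowerSemicontinuous (localAffine y δ l r) := by
  intro p v hv
  by_cases hp : p.1 ∈ Metric.ball y δ
  · have hcont : Continuous fun q : E × E => ENNReal.ofReal (l q.2 + r) :=
      ENNReal.continuous_ofReal.comp (by fun_prop)
    rw [localAffine, indicator_of_mem hp] at hv
    filter_upwards [hcont.continuousAt.eventually_const_lt hv,
      (Metric.isOpen_ball.preimage continuous_fst).mem_nhds hp] with q hq1 hq2
    rw [localAffine, indicator_of_mem (show q.1 ∈ Metric.ball y δ from hq2)]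
    exact hq1
  · simp [localAffine, indicator_of_notMem hp] at hv

variable [FiniteDimensional ℝ E]

/-- An affine minorant of `L x₀`, lowered slightly, remains a minorant of `L x` for all `x` near
`x₀`. Joint lower semicontinuity gives this for `u` in a compact ball, and superlinear growth,
uniform in `x`, gives it outside. -/
theorem exists_locally_uniform_affine_minorant {L : E → E → ℝ≥0∞}
    (hlsc : LowerSemicontinuous fun p : E × E => L p.1 p.2)
    (hconv : ∀ (x u v : E) (a b : ℝ≥0), a + b = 1 →
      L x (a • u + b • v) ≤ a * L x u + b * L x v)
    (hgrow : ∀ c : ℝ≥0, ∃ C : ℝ≥0, ∀ x u, c * ‖u‖ₑ ≤ L x u + C)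
    {x₀ u₀ : E} {c : ℝ} (hc0 : 0 ≤ c) (hc : ENNReal.ofReal c < L x₀ u₀) :
    ∃ (l : E →L[ℝ] ℝ) (r : ℝ), (∀ᶠ x in 𝓝 x₀, ∀ u, ENNReal.ofReal (l u + r) ≤ L x u) ∧
      c < l u₀ + r := by
  have hproper : ProperSpace E := FiniteDimensional.proper ℝ E
  obtain ⟨l, r', hl, hr⟩ := exists_affine_minorant (f := L x₀)
    (hlsc.comp (Continuous.prodMk_right x₀)) (hconv x₀) hc0 hc
  obtain ⟨r, hr1, hr2⟩ := exists_between (show c - l u₀ < r' by linarith)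
  refine ⟨l, r, ?_, by linarith⟩
  obtain ⟨C, hC⟩ := hgrow (‖l‖₊ + 1)
  -- outside this ball the growth of `L` beats the affine function, uniformly in `x`
  set R : ℝ := C + |r| with hR
  have hfar : ∀ x u, R ≤ ‖u‖ → ENNReal.ofReal (l u + r) ≤ L x u := by
    intro x u hu
    by_cases htop : L x u = ⊤
    · simp [htop]
    have h1 := hC x u
    rw [ENNReal.ofReal_le_iff_le_toReal htop]
    have h2 : (‖l‖ + 1) * ‖u‖ ≤ (L x u).toReal + C := by
      have := ENNReal.toReal_mono (by finiteness) h1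
      rw [ENNReal.toReal_add htop (by simp)] at this
      simpa [ENNReal.toReal_mul, ENNReal.toReal_add] using this
    have h3 : l u ≤ ‖l‖ * ‖u‖ := (le_abs_self _).trans (l.le_opNorm u)
    have h4 := le_abs_self r
    nlinarith
  have hnear : ∀ᶠ x in 𝓝 x₀, ∀ u ∈ Metric.closedBall (0 : E) R,
      ENNReal.ofReal (l u + r) ≤ L x u := by
    refine (isCompact_closedBall (0 : E) R).eventually_forall_of_forall_eventually fun u _ => ?_
    have hcont : Continuous fun p : E × E => l p.2 + r := by fun_prop
    rcases lt_or_ge (l u + r) 0 with hneg | hpos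
    · filter_upwards [hcont.continuousAt.eventually_lt_const
        (show (fun p : E × E => l p.2 + r) (x₀, u) < 0 from hneg)] with p hp
      rw [ENNReal.ofReal_of_nonpos hp.le]
      exact zero_le
    · have h1 : ENNReal.ofReal (l u + r) < L x₀ u :=
        ((ENNReal.ofReal_lt_ofReal_iff (by linarith)).2 (by linarith)).trans_le (hl u)
      obtain ⟨v, hv1, hv2⟩ := exists_between h1
      filter_upwards [(ENNReal.continuous_ofReal.comp hcont).continuousAt.eventually_lt_const
        (show (ENNReal.ofReal ∘ fun p : E × E => l p.2 + r) (x₀, u) < v from hv1),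
        hlsc (x₀, u) v hv2] with p hp1 hp2
      exact (hp1.trans hp2).le
  filter_upwards [hnear] with x hx u
  rcases le_total R ‖u‖ with h | h
  · exact hfar x u h
  · exact hx u (by simpa using h)

/-- A jointly lower semicontinuous integrand that is convex and superlinear in the second variable
is the supremum of countably many functions `localAffine`. Each of them comes from an affine
function that is a minorant on a ball of twice the radius; the slack is what allows the state to be
perturbed in the lower semicontinuity of the action. -/
theorem exists_countable_localAffine {L : E → E → ℝ≥0∞}
    (hlsc : LowerSemicontinuous fun p : E × E => L p.1 p.2)
    (hconv : ∀ (x u v : E) (a b : ℝ≥0), a + b = 1 →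
      L x (a • u + b • v) ≤ a * L x u + b * L x v)
    (hgrow : ∀ c : ℝ≥0, ∃ C : ℝ≥0, ∀ x u, c * ‖u‖ₑ ≤ L x u + C) :
    ∃ 𝓕 : Set (E × E → ℝ≥0∞), 𝓕.Countable ∧ IsLUB 𝓕 (fun p => L p.1 p.2) ∧
      ∀ f ∈ 𝓕, ∃ (y : E) (δ : ℝ) (l : E →L[ℝ] ℝ) (r : ℝ), 0 < δ ∧ f = localAffine y δ l r ∧
        ∀ x ∈ Metric.ball y (2 * δ), ∀ u, ENNReal.ofReal (l u + r) ≤ L x u := by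
  have hproper : ProperSpace E := FiniteDimensional.proper ℝ E
  set 𝓖 : Set (E × E → ℝ≥0∞) := {f | ∃ (y : E) (δ : ℝ) (l : E →L[ℝ] ℝ) (r : ℝ), 0 < δ ∧
    f = localAffine y δ l r ∧
    ∀ x ∈ Metric.ball y (2 * δ), ∀ u, ENNReal.ofReal (l u + r) ≤ L x u} with h𝓖
  have hlub : IsLUB 𝓖 (fun p => L p.1 p.2) := by
    constructor
    · rintro f ⟨y, δ, l, r, hδ, rfl, hle⟩ p
      by_cases hp : p.1 ∈ Metric.ball y δ
      · simp only [localAffine, indicator_of_mem hp]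
        exact hle _ (Metric.ball_subset_ball (by linarith) hp) _
      · simp [localAffine, indicator_of_notMem hp]
    · intro s hs p
      refine le_of_forall_lt fun v hv => ?_
      have hvt : v ≠ ⊤ := hv.ne_top
      obtain ⟨l, r, hev, hc⟩ := exists_locally_uniform_affine_minorant hlsc hconv hgrow
        (c := v.toReal) ENNReal.toReal_nonneg (x₀ := p.1) (u₀ := p.2)
        (by rwa [ENNReal.ofReal_toReal hvt])
      obtain ⟨δ, hδ, hball⟩ := Metric.eventually_nhds_iff_ball.1 hev
      have hmem : localAffine p.1 (δ / 2) l r ∈ 𝓖 :=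
        ⟨p.1, δ / 2, l, r, by positivity, rfl, fun x hx => hball x (by convert! hx using 2; ring)⟩
      refine lt_of_lt_of_le ?_ (hs hmem p)
      rw [localAffine, indicator_of_mem (Metric.mem_ball_self (by positivity))]
      exact (ENNReal.lt_ofReal_iff_toReal_lt hvt).2 hc
  obtain ⟨𝓕, hsub, hcount, h𝓕⟩ := exists_countable_lowerSemicontinuous_isLUB (𝓕 := 𝓖)
    (by rintro f ⟨y, δ, l, r, -, rfl, -⟩; exact lowerSemicontinuous_localAffine y δ l r) hlub
  exact ⟨𝓕, hcount, h𝓕, fun f hf => hsub hf⟩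

end AffineMinorants

/-! ### Lower bounds for limits of integrals -/

section LowerBounds

variable {α : Type*} [MeasurableSpace α] {μ : Measure α} {F : ℕ → α → ℝ≥0∞}

theorem add_liminf_le_liminf_add (u v : ℕ → ℝ≥0∞) :
    liminf u atTop + liminf v atTop ≤ liminf (fun n => u n + v n) atTop := by
  simp only [liminf_eq_iSup_iInf_of_nat]
  rw [ENNReal.iSup_add_iSup_of_monotone]
  · exact iSup_mono fun n => le_iInf₂ fun i hi => add_le_add (iInf₂_le i hi) (iInf₂_le i hi)
  all_goals exact fun m n hmn => biInf_mono fun i hi => hmn.trans hi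

/-- Because the bounds hold on every measurable set, they can be combined by splitting the set
according to which of the two functions is larger. -/
theorem setLIntegral_max_le_liminf {f g : α → ℝ≥0∞} (hf : Measurable f) (hg : Measurable g)
    (hfF : ∀ A, MeasurableSet A → ∫⁻ x in A, f x ∂μ ≤ liminf (fun n => ∫⁻ x in A, F n x ∂μ) atTop)
    (hgF : ∀ A, MeasurableSet A → ∫⁻ x in A, g x ∂μ ≤ liminf (fun n => ∫⁻ x in A, F n x ∂μ) atTop)
    {A : Set α} (hA : MeasurableSet A) :
    ∫⁻ x in A, max (f x) (g x) ∂μ ≤ liminf (fun n => ∫⁻ x in A, F n x ∂μ) atTop := by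
  set B := {x | f x ≤ g x} with hB
  have hBm : MeasurableSet B := measurableSet_le hf hg
  have h1 : ∫⁻ x in A ∩ B, max (f x) (g x) ∂μ = ∫⁻ x in A ∩ B, g x ∂μ :=
    setLIntegral_congr_fun (hA.inter hBm) fun x hx => max_eq_right hx.2
  have h2 : ∫⁻ x in A \ B, max (f x) (g x) ∂μ = ∫⁻ x in A \ B, f x ∂μ :=
    setLIntegral_congr_fun (hA.diff hBm) fun x hx => max_eq_left (not_le.1 hx.2).le
  rw [← lintegral_inter_add_sdiff _ A hBm, h1, h2]
  refine (add_le_add (hgF _ (hA.inter hBm)) (hfF _ (hA.diff hBm))).trans ?_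
  refine (add_liminf_le_liminf_add _ _).trans (le_of_eq ?_)
  congr 1
  ext n
  exact lintegral_inter_add_sdiff _ A hBm

theorem setLIntegral_iSup_le_liminf {f : ℕ → α → ℝ≥0∞} (hf : ∀ i, Measurable (f i))
    (hfF : ∀ i A, MeasurableSet A →
      ∫⁻ x in A, f i x ∂μ ≤ liminf (fun n => ∫⁻ x in A, F n x ∂μ) atTop)
    {A : Set α} (hA : MeasurableSet A) :
    ∫⁻ x in A, ⨆ i, f i x ∂μ ≤ liminf (fun n => ∫⁻ x in A, F n x ∂μ) atTop := by
  have hmeas : ∀ k, Measurable (partialSups f k) := by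
    intro k
    induction k with
    | zero => simpa using hf 0
    | succ k ih => rw [partialSups_add_one]; exact ih.sup (hf _)
  have hle : ∀ k A, MeasurableSet A →
      ∫⁻ x in A, partialSups f k x ∂μ ≤ liminf (fun n => ∫⁻ x in A, F n x ∂μ) atTop := by
    intro k
    induction k with
    | zero => simpa using hfF 0
    | succ k ih =>
      intro A hA
      rw [partialSups_add_one]
      exact setLIntegral_max_le_liminf (hmeas k) (hf _) ih (hfF _) hA
  have hsup : ∀ x, ⨆ i, f i x = ⨆ k, partialSups f k x := by
    intro x
    rw [← iSup_apply, ← iSup_partialSups_eq, iSup_apply]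
  simp_rw [hsup]
  rw [lintegral_iSup hmeas fun i j hij x => (partialSups f).monotone hij x]
  exact iSup_le fun k => hle k A hA

/-- A lower bound for the integrals over all measurable sets carries over to integrals against
nonnegative weights, which may take the value `∞`. -/
theorem lintegral_mul_le_liminf {f : α → ℝ≥0∞} (hf : Measurable f) (hF : ∀ n, Measurable (F n))
    (hfF : ∀ A, MeasurableSet A → ∫⁻ x in A, f x ∂μ ≤ liminf (fun n => ∫⁻ x in A, F n x ∂μ) atTop)
    {w : α → ℝ≥0∞} (hw : Measurable w) :
    ∫⁻ x, w x * f x ∂μ ≤ liminf (fun n => ∫⁻ x, w x * F n x ∂μ) atTop := by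
  refine Measurable.ennreal_induction (motive := fun w =>
    ∫⁻ x, w x * f x ∂μ ≤ liminf (fun n => ∫⁻ x, w x * F n x ∂μ) atTop) ?_ ?_ ?_ hw
  · intro c A hA
    have h : ∀ f : α → ℝ≥0∞, Measurable f →
        ∫⁻ x, A.indicator (fun _ => c) x * f x ∂μ = c * ∫⁻ x in A, f x ∂μ := by
      intro f hf
      rw [← lintegral_const_mul _ hf, ← lintegral_indicator hA]
      congr 1
      ext x
      by_cases hx : x ∈ A <;> simp [hx]
    rw [h f hf]
    simp_rw [fun n => h (F n) (hF n)]
    calc c * ∫⁻ x in A, f x ∂μ ≤ liminf (fun _ : ℕ => c) atTop *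
          liminf (fun n => ∫⁻ x in A, F n x ∂μ) atTop := by
            rw [liminf_const]; exact mul_le_mul_right (hfF A hA) c
      _ ≤ _ := ENNReal.le_liminf_mul
  · intro v w _ hv hw ihv ihw
    simp only [Pi.add_apply, add_mul]
    rw [lintegral_add_left (by fun_prop : Measurable fun x => v x * f x)]
    simp_rw [fun n => lintegral_add_left (μ := μ)
      (by fun_prop : Measurable fun x => v x * F n x) fun x => w x * F n x]
    exact (add_le_add ihv ihw).trans (add_liminf_le_liminf_add _ _)
  · intro w hw hmono ih
    simp_rw [ENNReal.iSup_mul]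
    rw [lintegral_iSup (fun k => (by fun_prop : Measurable fun x => w k x * f x))
      fun i j hij x => mul_le_mul_left (hmono hij x) _]
    refine iSup_le fun k => (ih k).trans (liminf_le_liminf (Eventually.of_forall fun n => ?_))
    exact lintegral_mono fun x => le_iSup (fun k => w k x * F n x) k

end LowerBounds

/-! ### Weak convergence from convergence of primitives -/

section WeakConvergence

variable {E : Type*} [NormedAddCommGroup E] [NormedSpace ℝ E]

/-- Weak convergence of uniformly integrable functions on the line follows from the convergence
of their primitives. -/
theorem tendsto_setIntegral_of_tendsto_Iic {μ : Measure ℝ} [IsFiniteMeasure μ] {u : ℕ → ℝ → E}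
    {v : ℝ → E} (hu : ∀ n, Integrable (u n) μ) (hv : Integrable v μ)
    (hui : ∀ ε : ℝ, 0 < ε → ∃ δ : ℝ≥0∞, 0 < δ ∧ ∀ n A, MeasurableSet A → μ A ≤ δ →
      ∫ x in A, ‖u n x‖ ∂μ ≤ ε)
    (hIic : ∀ a, Tendsto (fun n => ∫ x in Iic a, u n x ∂μ) atTop (𝓝 (∫ x in Iic a, v x ∂μ)))
    (huniv : Tendsto (fun n => ∫ x, u n x ∂μ) atTop (𝓝 (∫ x, v x ∂μ)))
    {A : Set ℝ} (hA : MeasurableSet A) :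
    Tendsto (fun n => ∫ x in A, u n x ∂μ) atTop (𝓝 (∫ x in A, v x ∂μ)) := by
  induction A, hA using MeasurableSpace.induction_on_inter
    ((BorelSpace.measurable_eq (α := ℝ)).trans (borel_eq_generateFrom_Iic ℝ)) isPiSystem_Iic with
  | empty => simp
  | basic t ht => obtain ⟨a, rfl⟩ := ht; exact hIic a
  | compl t htm ih =>
    have h : ∀ w : ℝ → E, Integrable w μ →
        ∫ x in tᶜ, w x ∂μ = ∫ x, w x ∂μ - ∫ x in t, w x ∂μ := fun w hw => by
      rw [← integral_add_compl htm hw]; abel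
    rw [h v hv]
    simp_rw [fun n => h (u n) (hu n)]
    exact huniv.sub ih
  | iUnion f hdisj hfm ih =>
    rw [Metric.tendsto_nhds]
    intro ε hε
    obtain ⟨δ, hδ, hδu⟩ := hui (ε / 3) (by positivity)
    have htail := tendsto_measure_biUnion_Ici_zero_of_pairwise_disjoint (μ := μ)
      (fun i => (hfm i).nullMeasurableSet) hdisj
    have htailv : Tendsto (fun k => ∫ x in ⋃ i ≥ k, f i, ‖v x‖ ∂μ) atTop (𝓝 0) :=
      hv.norm.tendsto_setIntegral_nhds_zero htail
    obtain ⟨k, hk1, hk2⟩ := ((htail.eventually (eventually_le_nhds hδ)).and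
      (htailv.eventually (eventually_le_nhds (show (0 : ℝ) < ε / 3 by positivity)))).exists
    have htm : MeasurableSet (⋃ i ≥ k, f i) :=
      MeasurableSet.biUnion (to_countable _) fun i _ => hfm i
    have hsplit : ∀ w : ℝ → E, Integrable w μ → ∫ x in ⋃ i, f i, w x ∂μ =
        ∑ i ∈ Finset.range k, ∫ x in f i, w x ∂μ + ∫ x in ⋃ i ≥ k, f i, w x ∂μ := by
      intro w hw
      rw [← integral_biUnion_finset _ (fun i _ => hfm i) (hdisj.set_pairwise _)
        (fun i _ => hw.integrableOn), ← setIntegral_union _ htm hw.integrableOn hw.integrableOn]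
      · congr 2
        ext x
        simp only [mem_iUnion, mem_union, Finset.mem_range, exists_prop]
        constructor
        · rintro ⟨i, hi⟩
          rcases lt_or_ge i k with h | h
          · exact Or.inl ⟨i, h, hi⟩
          · exact Or.inr ⟨i, h, hi⟩
        · rintro (⟨i, -, hi⟩ | ⟨i, -, hi⟩) <;> exact ⟨i, hi⟩
      · simp only [disjoint_iUnion_left, disjoint_iUnion_right]
        intro i hi j hj
        exact hdisj (by simp only [Finset.mem_range] at hj; omega)
    have hsum : Tendsto (fun n => ∑ i ∈ Finset.range k, ∫ x in f i, u n x ∂μ) atTop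
        (𝓝 (∑ i ∈ Finset.range k, ∫ x in f i, v x ∂μ)) := tendsto_finsetSum _ fun i _ => ih i
    filter_upwards [Metric.tendsto_nhds.1 hsum (ε / 3) (by positivity)] with n hn
    rw [hsplit _ (hu n), hsplit _ hv]
    have h1 : ‖∫ x in ⋃ i ≥ k, f i, u n x ∂μ‖ ≤ ε / 3 :=
      (norm_integral_le_integral_norm _).trans (hδu n _ htm hk1)
    have h2 : ‖∫ x in ⋃ i ≥ k, f i, v x ∂μ‖ ≤ ε / 3 :=
      (norm_integral_le_integral_norm _).trans hk2
    refine (dist_add_add_le _ _ _ _).trans_lt ?_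
    rw [dist_eq_norm (∫ x in ⋃ i ≥ k, f i, u n x ∂μ)]
    have := norm_sub_le (∫ x in ⋃ i ≥ k, f i, u n x ∂μ) (∫ x in ⋃ i ≥ k, f i, v x ∂μ)
    linarith

end WeakConvergence

/-! ### Absolutely continuous paths -/

section FTC

variable {d : ℕ} {f : ℝ → Euc d} {a b : ℝ}

theorem absolutelyContinuousOnInterval_apply (hf : AbsolutelyContinuousOnInterval f a b)
    (i : Fin d) : AbsolutelyContinuousOnInterval (fun t => f t i) a b := by
  refine squeeze_zero (fun t => Finset.sum_nonneg fun _ _ => dist_nonneg) (fun t => ?_) hf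
  refine Finset.sum_le_sum fun j _ => ?_
  rw [dist_eq_norm, dist_eq_norm, ← PiLp.sub_apply]
  exact PiLp.norm_apply_le _ i

theorem ae_deriv_apply (hf : AbsolutelyContinuousOnInterval f a b) (i : Fin d) :
    ∀ᵐ t, t ∈ uIcc a b → deriv (fun t => f t i) t = deriv f t i := by
  filter_upwards [hf.boundedVariationOn.ae_differentiableAt_of_mem_uIcc] with t ht hmem
  exact ((EuclideanSpace.proj (𝕜 := ℝ) i).hasFDerivAt.comp_hasDerivAt t
    (ht hmem).hasDerivAt).deriv

theorem intervalIntegrable_deriv (hf : AbsolutelyContinuousOnInterval f a b) :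
    IntervalIntegrable (deriv f) volume a b := by
  rw [intervalIntegrable_iff, IntegrableOn, integrable_piLp_iff]
  intro i
  have h := (absolutelyContinuousOnInterval_apply hf i).intervalIntegrable_deriv
  rw [intervalIntegrable_iff, IntegrableOn] at h
  refine h.congr ?_
  rw [EventuallyEq, ae_restrict_iff' measurableSet_uIoc]
  filter_upwards [ae_deriv_apply hf i] with t ht hmem
  exact ht (uIoc_subset_uIcc hmem)

/-- The fundamental theorem of calculus for absolutely continuous paths in `ℝ^d`. -/
theorem intervalIntegral_deriv_eq_sub (hf : AbsolutelyContinuousOnInterval f a b) :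
    ∫ t in a..b, deriv f t = f b - f a := by
  have hint := intervalIntegrable_deriv hf
  ext i
  have h := (EuclideanSpace.proj (𝕜 := ℝ) i).intervalIntegral_comp_comm hint
  have h' : (∫ t in a..b, deriv f t) i = ∫ t in a..b, deriv f t i := h.symm
  rw [h', PiLp.sub_apply, ← (absolutelyContinuousOnInterval_apply hf i).integral_deriv_eq_sub]
  refine intervalIntegral.integral_congr_ae ?_
  filter_upwards [ae_deriv_apply hf i] with t ht hmem
  exact (ht (uIoc_subset_uIcc hmem)).symm

end FTC

/-! ### Paths of bounded action -/

theorem ofReal_integral_le_lintegral_ofReal {α : Type*} [MeasurableSpace α] {μ : Measure α}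
    {f : α → ℝ} (hf : Integrable f μ) :
    ENNReal.ofReal (∫ x, f x ∂μ) ≤ ∫⁻ x, ENNReal.ofReal (f x) ∂μ := by
  rw [integral_eq_lintegral_pos_part_sub_lintegral_neg_part hf]
  exact (ENNReal.ofReal_le_ofReal (sub_le_self _ ENNReal.toReal_nonneg)).trans
    ENNReal.ofReal_toReal_le

section Growth

variable {E : Type*} [NormedAddCommGroup E] {L : E → E → ℝ≥0∞}

/-- De la Vallée-Poussin: velocities with bounded action under a superlinear integrand are uniformly
integrable, uniformly over all paths and measures. -/
theorem exists_uniform_setLIntegral_enorm_le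
    (hgrow : ∀ c : ℝ≥0, ∃ C : ℝ≥0, ∀ x u, c * ‖u‖ₑ ≤ L x u + C) (M : ℝ≥0) {ε : ℝ≥0} (hε : 0 < ε) :
    ∃ δ : ℝ≥0, 0 < δ ∧ ∀ (μ : Measure ℝ) (x u : ℝ → E), ∫⁻ t, L (x t) (u t) ∂μ ≤ M →
      ∀ A, μ A ≤ δ → ∫⁻ t in A, ‖u t‖ₑ ∂μ ≤ ε := by
  obtain ⟨C, hC⟩ := hgrow ((M + 1) / ε)
  have hc : 0 < (M + 1) / ε := by positivity
  refine ⟨(C + 1)⁻¹, by positivity, fun μ x u hM A hA => ?_⟩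
  have h1 : ((M + 1) / ε : ℝ≥0) * ∫⁻ t in A, ‖u t‖ₑ ∂μ ≤ (M + 1 : ℝ≥0) := by
    calc ((M + 1) / ε : ℝ≥0) * ∫⁻ t in A, ‖u t‖ₑ ∂μ
        ≤ ∫⁻ t in A, ((M + 1) / ε : ℝ≥0) * ‖u t‖ₑ ∂μ := lintegral_const_mul_le _ _
      _ ≤ ∫⁻ t in A, (L (x t) (u t) + C) ∂μ := lintegral_mono fun t => hC _ _
      _ = ∫⁻ t in A, L (x t) (u t) ∂μ + C * μ A := by
          rw [lintegral_add_right _ measurable_const, setLIntegral_const]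
      _ ≤ M + C * ((C + 1)⁻¹ : ℝ≥0) :=
          add_le_add ((setLIntegral_le_lintegral _ _).trans hM) (mul_le_mul_right hA _)
      _ ≤ (M + 1 : ℝ≥0) := by
          rw [← ENNReal.coe_mul, ← ENNReal.coe_add, ENNReal.coe_le_coe]
          gcongr
          rw [← div_eq_mul_inv]
          exact div_le_one_of_le₀ (by simp) (by positivity)
  have h2 : (M + 1 : ℝ≥0) = ((M + 1) / ε : ℝ≥0) * ε := by field_simp
  generalize (M + 1) / ε = c at hc h1 h2
  rw [h2, ENNReal.coe_mul] at h1
  exact (ENNReal.mul_le_mul_iff_right (by simpa using hc.ne') (by simp)).1 h1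

end Growth

section Paths

variable {d : ℕ} {T : ℝ} {L : Euc d → Euc d → ℝ≥0∞} {f : ℝ → Euc d}

theorem edist_le_setLIntegral_deriv (hT : 0 ≤ T) (hf : AbsolutelyContinuousOnInterval f 0 T)
    {a b : ℝ} (ha : a ∈ Icc 0 T) (hb : b ∈ Icc 0 T) :
    edist (f a) (f b) ≤ ∫⁻ t in uIoc a b, ‖deriv f t‖ₑ ∂(volume.restrict (Icc 0 T)) := by
  have hsub : uIcc a b ⊆ uIcc 0 T := by
    rw [uIcc_of_le hT]; exact uIcc_subset_Icc ha hb
  have hab := intervalIntegral_deriv_eq_sub (hf.mono hsub)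
  have hsub' : uIoc a b ⊆ Icc 0 T := by
    rw [← uIcc_of_le hT]; exact uIoc_subset_uIcc.trans hsub
  rw [Measure.restrict_restrict measurableSet_uIoc, inter_eq_left.2 hsub', edist_comm,
    edist_eq_enorm_sub, ← hab]
  calc ‖∫ t in a..b, deriv f t‖ₑ = ‖∫ t in uIoc a b, deriv f t‖ₑ := by
        rw [← ofReal_norm, ← ofReal_norm, intervalIntegral.norm_intervalIntegral_eq]
    _ ≤ _ := enorm_integral_le_lintegral_enorm _

theorem sum_edist_le_setLIntegral_deriv (hT : 0 ≤ T) (hf : AbsolutelyContinuousOnInterval f 0 T)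
    {I : ℕ × (ℕ → ℝ × ℝ)} (hI : I ∈ AbsolutelyContinuousOnInterval.disjWithin 0 T) :
    ∑ i ∈ Finset.range I.1, edist (f (I.2 i).1) (f (I.2 i).2) ≤
      ∫⁻ t in ⋃ i ∈ Finset.range I.1, uIoc (I.2 i).1 (I.2 i).2, ‖deriv f t‖ₑ
        ∂(volume.restrict (Icc 0 T)) := by
  rw [lintegral_biUnion_finset hI.2 fun i _ => measurableSet_uIoc]
  refine Finset.sum_le_sum fun i hi => ?_
  have h := hI.1 i hi
  rw [uIcc_of_le hT] at h
  exact edist_le_setLIntegral_deriv hT hf h.1 h.2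

theorem measure_biUnion_uIoc_le (I : ℕ × (ℕ → ℝ × ℝ)) :
    volume.restrict (Icc 0 T) (⋃ i ∈ Finset.range I.1, uIoc (I.2 i).1 (I.2 i).2) ≤
      ENNReal.ofReal (∑ i ∈ Finset.range I.1, dist (I.2 i).1 (I.2 i).2) := by
  refine (Measure.restrict_le_self _).trans ((measure_biUnion_finset_le _ _).trans (le_of_eq ?_))
  rw [ENNReal.ofReal_sum_of_nonneg fun _ _ => dist_nonneg]
  refine Finset.sum_congr rfl fun i _ => ?_
  simp [uIoc, Real.dist_eq, max_sub_min_eq_abs']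

/-- Absolute continuity passes to pointwise limits of paths with bounded action. -/
theorem absolutelyContinuousOnInterval_of_tendsto (hT : 0 ≤ T)
    (hgrow : ∀ c : ℝ≥0, ∃ C : ℝ≥0, ∀ x u, c * ‖u‖ₑ ≤ L x u + C) {M : ℝ≥0}
    {F : ℕ → ℝ → Euc d} (hF : ∀ n, AbsolutelyContinuousOnInterval (F n) 0 T)
    (hM : ∀ n, ∫⁻ t in Icc 0 T, L (F n t) (deriv (F n) t) ≤ M)
    (hlim : ∀ t, Tendsto (fun n => F n t) atTop (𝓝 (f t))) :
    AbsolutelyContinuousOnInterval f 0 T := by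
  rw [absolutelyContinuousOnInterval_iff]
  intro ε hε
  lift ε to ℝ≥0 using hε.le
  obtain ⟨δ, hδ, hδM⟩ := exists_uniform_setLIntegral_enorm_le hgrow M
    (show 0 < ε / 2 from half_pos (by exact_mod_cast hε))
  refine ⟨δ, by exact_mod_cast hδ, fun I hI hsum => ?_⟩
  have hn : ∀ n, ∑ i ∈ Finset.range I.1, dist (F n (I.2 i).1) (F n (I.2 i).2) ≤ (ε / 2 : ℝ≥0) := by
    intro n
    have h1 := (sum_edist_le_setLIntegral_deriv hT (hF n) hI).trans
      (hδM _ _ _ (hM n) _ ((measure_biUnion_uIoc_le I).trans ?_))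
    · simp_rw [edist_dist] at h1
      rw [← ENNReal.ofReal_sum_of_nonneg fun _ _ => dist_nonneg] at h1
      exact (ENNReal.ofReal_le_iff_le_toReal ENNReal.coe_ne_top).1 h1
    · rw [ENNReal.ofReal_le_iff_le_toReal (by simp)]
      exact hsum.le
  have hlim' : Tendsto (fun n => ∑ i ∈ Finset.range I.1, dist (F n (I.2 i).1) (F n (I.2 i).2))
      atTop (𝓝 (∑ i ∈ Finset.range I.1, dist (f (I.2 i).1) (f (I.2 i).2))) :=
    tendsto_finsetSum _ fun i _ => (hlim _).dist (hlim _)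
  refine (le_of_tendsto' hlim' hn).trans_lt ?_
  rw [NNReal.coe_div]
  simpa using hε

theorem integrableOn_deriv (hT : 0 ≤ T) (hf : AbsolutelyContinuousOnInterval f 0 T) :
    Integrable (deriv f) (volume.restrict (Icc 0 T)) := by
  have h := intervalIntegrable_deriv hf
  rwa [intervalIntegrable_iff_integrableOn_Icc_of_le hT] at h

theorem setIntegral_Iic_deriv (hT : 0 ≤ T) (hf : AbsolutelyContinuousOnInterval f 0 T) {a : ℝ}
    (ha : 0 ≤ a) :
    ∫ t in Iic a, deriv f t ∂(volume.restrict (Icc 0 T)) = f (min a T) - f 0 := by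
  have hm : 0 ≤ min a T := le_min ha hT
  rw [Measure.restrict_restrict measurableSet_Iic]
  have : Iic a ∩ Icc 0 T = Icc 0 (min a T) := by ext; simp; tauto
  rw [this, integral_Icc_eq_integral_Ioc, ← intervalIntegral.integral_of_le hm,
    intervalIntegral_deriv_eq_sub (hf.mono ?_)]
  rw [uIcc_of_le hm, uIcc_of_le hT]
  exact Icc_subset_Icc_right (min_le_right _ _)

/-- The derivatives of paths with bounded action converge weakly in `L¹`. -/
theorem tendsto_setIntegral_deriv (hT : 0 ≤ T)
    (hgrow : ∀ c : ℝ≥0, ∃ C : ℝ≥0, ∀ x u, c * ‖u‖ₑ ≤ L x u + C) {M : ℝ≥0}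
    {F : ℕ → ℝ → Euc d} (hF : ∀ n, AbsolutelyContinuousOnInterval (F n) 0 T)
    (hM : ∀ n, ∫⁻ t in Icc 0 T, L (F n t) (deriv (F n) t) ≤ M)
    (hf : AbsolutelyContinuousOnInterval f 0 T)
    (hlim : ∀ t, Tendsto (fun n => F n t) atTop (𝓝 (f t))) {A : Set ℝ} (hA : MeasurableSet A) :
    Tendsto (fun n => ∫ t in A, deriv (F n) t ∂(volume.restrict (Icc 0 T))) atTop
      (𝓝 (∫ t in A, deriv f t ∂(volume.restrict (Icc 0 T)))) := by
  refine tendsto_setIntegral_of_tendsto_Iic (fun n => integrableOn_deriv hT (hF n))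
    (integrableOn_deriv hT hf) ?_ ?_ ?_ hA
  · intro ε hε
    lift ε to ℝ≥0 using hε.le
    obtain ⟨δ, hδ, hδM⟩ := exists_uniform_setLIntegral_enorm_le hgrow M
      (show 0 < ε by exact_mod_cast hε)
    refine ⟨δ, by exact_mod_cast hδ, fun n B hB hBδ => ?_⟩
    rw [integral_norm_eq_lintegral_enorm (integrableOn_deriv hT (hF n)).1.restrict]
    exact ENNReal.toReal_le_of_le_ofReal (by positivity)
      ((hδM _ _ _ (hM n) B hBδ).trans (by simp))
  · intro a
    rcases lt_or_ge a 0 with ha | ha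
    · have : Iic a ∩ Icc 0 T = ∅ := by
        ext t; simp only [mem_inter_iff, mem_Iic, mem_Icc, mem_empty_iff_false, iff_false]
        rintro ⟨h1, h2, -⟩; linarith
      simp [Measure.restrict_restrict measurableSet_Iic, this]
    · rw [setIntegral_Iic_deriv hT hf ha]
      simp_rw [fun n => setIntegral_Iic_deriv hT (hF n) ha]
      exact (hlim _).sub (hlim _)
  · have h : ∀ f : ℝ → Euc d, AbsolutelyContinuousOnInterval f 0 T →
        ∫ t in Icc 0 T, deriv f t = f T - f 0 := fun f hf => by
      rw [integral_Icc_eq_integral_Ioc, ← intervalIntegral.integral_of_le hT,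
        intervalIntegral_deriv_eq_sub hf]
    rw [h f hf]
    simp_rw [fun n => h (F n) (hF n)]
    exact (hlim _).sub (hlim _)

/-- Lower semicontinuity of the action, localised to an arbitrary measurable set of times. -/
theorem setLIntegral_action_le_liminf (hT : 0 ≤ T)
    (hlsc : LowerSemicontinuous fun p : Euc d × Euc d => L p.1 p.2)
    (hconv : ∀ (x u v : Euc d) (a b : ℝ≥0), a + b = 1 →
      L x (a • u + b • v) ≤ a * L x u + b * L x v)
    (hgrow : ∀ c : ℝ≥0, ∃ C : ℝ≥0, ∀ x u, c * ‖u‖ₑ ≤ L x u + C) {M : ℝ≥0}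
    {F : ℕ → ℝ → Euc d} (hF : ∀ n, AbsolutelyContinuousOnInterval (F n) 0 T)
    (hM : ∀ n, ∫⁻ t in Icc 0 T, L (F n t) (deriv (F n) t) ≤ M)
    (hf : AbsolutelyContinuousOnInterval f 0 T) (hfc : Continuous f)
    (hlim : TendstoUniformly F f atTop) {A : Set ℝ} (hA : MeasurableSet A) :
    ∫⁻ t in A, L (f t) (deriv f t) ∂(volume.restrict (Icc 0 T)) ≤
      liminf (fun n => ∫⁻ t in A, L (F n t) (deriv (F n) t) ∂(volume.restrict (Icc 0 T)))
        atTop := by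
  obtain ⟨𝓕, hcount, hlub, h𝓕⟩ := exists_countable_localAffine hlsc hconv hgrow
  rcases 𝓕.eq_empty_or_nonempty with rfl | hne
  · have h0 : ∀ x u, L x u = 0 := fun x u => by
      have := hlub.2 (show (0 : Euc d × Euc d → ℝ≥0∞) ∈ upperBounds ∅ by simp) (x, u)
      simpa using this
    simp [h0]
  obtain ⟨φ, hφ⟩ := hcount.exists_eq_range hne
  have hsup : ∀ x u, L x u = ⨆ i, φ i (x, u) := by
    intro x u
    have h1 := (isLUB_pi.1 hlub) (x, u)
    rw [hφ, ← range_comp] at h1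
    exact h1.unique isLUB_iSup
  have hrep : ∀ i, ∃ (y : Euc d) (δ : ℝ) (l : Euc d →L[ℝ] ℝ) (r : ℝ), 0 < δ ∧
      φ i = localAffine y δ l r ∧
      ∀ x ∈ Metric.ball y (2 * δ), ∀ u, ENNReal.ofReal (l u + r) ≤ L x u :=
    fun i => h𝓕 _ (hφ ▸ mem_range_self i)
  have hderiv : Measurable (deriv f) := measurable_deriv f
  simp_rw [hsup (f _)]
  refine setLIntegral_iSup_le_liminf (f := fun i t => φ i (f t, deriv f t)) (fun i => ?_)
    (fun i A hA => ?_) hA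
  · obtain ⟨y, δ, l, r, hδ, hi, hle⟩ := hrep i
    rw [hi]
    exact (lowerSemicontinuous_localAffine y δ l r).measurable.comp (hfc.measurable.prodMk hderiv)
  · obtain ⟨y, δ, l, r, hδ, hi, hle⟩ := hrep i
    rw [hi]
    set μ := volume.restrict (Icc 0 T) with hμ
    set B := {t | f t ∈ Metric.ball y δ ∧ 0 < l (deriv f t) + r} with hB
    have hlm : Measurable fun t => l (deriv f t) + r := by fun_prop
    have hBm : MeasurableSet B :=
      (hfc.measurable measurableSet_ball).inter (measurableSet_lt measurable_const hlm)
    have hABm := hA.inter hBm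
    -- on the fixed set `A ∩ B` the lower bound is affine in the velocity, so it passes to the weak
    -- limit of the derivatives
    have hint : ∀ g : ℝ → Euc d, AbsolutelyContinuousOnInterval g 0 T →
        Integrable (fun t => l (deriv g t) + r) (μ.restrict (A ∩ B)) := fun g hg =>
      (l.integrable_comp (integrableOn_deriv hT hg).restrict).add (integrable_const r)
    have hval : ∀ g : ℝ → Euc d, AbsolutelyContinuousOnInterval g 0 T →
        ∫ t in A ∩ B, (l (deriv g t) + r) ∂μ =
          l (∫ t in A ∩ B, deriv g t ∂μ) + ∫ _ in A ∩ B, r ∂μ := fun g hg => by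
      rw [integral_add (l.integrable_comp (integrableOn_deriv hT hg).restrict)
        (integrable_const r), l.integral_comp_comm (integrableOn_deriv hT hg).restrict]
    have h1 : ∫⁻ t in A, localAffine y δ l r (f t, deriv f t) ∂μ =
        ENNReal.ofReal (∫ t in A ∩ B, (l (deriv f t) + r) ∂μ) := by
      rw [ofReal_integral_eq_lintegral_ofReal (hint f hf)
        (by filter_upwards [ae_restrict_mem hABm] with t ht using ht.2.2.le),
        inter_comm A B, ← setLIntegral_indicator hBm]
      refine lintegral_congr fun t => ?_
      by_cases ht : f t ∈ Metric.ball y δ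
      · rcases lt_or_ge 0 (l (deriv f t) + r) with h0 | h0
        · rw [localAffine, indicator_of_mem ht, indicator_of_mem (show t ∈ B from ⟨ht, h0⟩)]
        · rw [localAffine, indicator_of_mem ht, indicator_of_notMem fun h => absurd h.2 h0.not_gt,
            ENNReal.ofReal_of_nonpos h0]
      · rw [localAffine, indicator_of_notMem ht, indicator_of_notMem fun h => ht h.1]
    have h2 : Tendsto (fun n => ENNReal.ofReal (∫ t in A ∩ B, (l (deriv (F n) t) + r) ∂μ)) atTop
        (𝓝 (ENNReal.ofReal (∫ t in A ∩ B, (l (deriv f t) + r) ∂μ))) := by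
      refine ENNReal.tendsto_ofReal ?_
      rw [hval f hf]
      simp_rw [fun n => hval (F n) (hF n)]
      exact ((l.continuous.tendsto _).comp (tendsto_setIntegral_deriv hT hgrow hF hM hf
        (fun t => hlim.tendsto_at t) hABm)).add_const _
    have h3 : ∀ᶠ n in atTop, ENNReal.ofReal (∫ t in A ∩ B, (l (deriv (F n) t) + r) ∂μ) ≤
        ∫⁻ t in A, L (F n t) (deriv (F n) t) ∂μ := by
      filter_upwards [Metric.tendstoUniformly_iff.1 hlim δ hδ] with n hn
      calc ENNReal.ofReal (∫ t in A ∩ B, (l (deriv (F n) t) + r) ∂μ)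
          ≤ ∫⁻ t in A ∩ B, ENNReal.ofReal (l (deriv (F n) t) + r) ∂μ :=
            ofReal_integral_le_lintegral_ofReal (hint _ (hF n))
        _ ≤ ∫⁻ t in A ∩ B, L (F n t) (deriv (F n) t) ∂μ := by
            refine setLIntegral_mono' hABm fun t ht => hle _ ?_ _
            have h4 := hn t
            have h5 : dist (f t) y < δ := ht.2.1
            rw [Metric.mem_ball]
            linarith [dist_triangle_left (F n t) y (f t)]
        _ ≤ _ := lintegral_mono_set inter_subset_left
    rw [h1, ← h2.liminf_eq]
    exact liminf_le_liminf h3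

end Paths

/-! ### Tonelli theorem for the action functional -/

section Action

variable {d : ℕ} {T : ℝ} {L : Euc d → Euc d → ℝ≥0∞} {h : ℝ → ℝ}

open scoped Classical in
/-- The functional `∫_0^T L(φ(t), φ'(t)) / h(t) dt` on paths started at `x₀`, for a general
integrand `L`. It takes the value `∞` at paths that are not absolutely continuous. -/
noncomputable def actionFn (L : Euc d → Euc d → ℝ≥0∞) (h : ℝ → ℝ) (hT : 0 < T) (x₀ : Euc d)
    (φ : C(Icc (0 : ℝ) T, Euc d)) : ℝ≥0∞ :=
  if AbsolutelyContinuousOnInterval (IccExtend hT.le φ) 0 T ∧ IccExtend hT.le φ 0 = x₀ then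
    ∫⁻ t in Icc 0 T,
      L (IccExtend hT.le φ t) (deriv (IccExtend hT.le φ) t) / ENNReal.ofReal (h t)
  else ⊤

theorem actionFn_le_coe_iff (hT : 0 < T) (x₀ : Euc d) (φ : C(Icc (0 : ℝ) T, Euc d)) (K : ℝ≥0) :
    actionFn L h hT x₀ φ ≤ K ↔
      AbsolutelyContinuousOnInterval (IccExtend hT.le φ) 0 T ∧ IccExtend hT.le φ 0 = x₀ ∧
      ∫⁻ t in Icc 0 T,
        L (IccExtend hT.le φ t) (deriv (IccExtend hT.le φ) t) / ENNReal.ofReal (h t) ≤ K := by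
  unfold actionFn
  split_ifs with hφ
  · exact ⟨fun h => ⟨hφ.1, hφ.2, h⟩, fun h => h.2.2⟩
  · simp only [top_le_iff, ENNReal.coe_ne_top, false_iff]
    tauto

/-- A weight `1 / h` with `h` bounded above can be removed at the cost of a constant. Where `h ≤ 0`
the weight is `∞`. -/
theorem setLIntegral_le_of_div_le {B K : ℝ≥0} (hB : ∀ t ∈ Icc 0 T, h t ≤ B) {F : ℝ → ℝ≥0∞}
    (hF : ∫⁻ t in Icc 0 T, F t / ENNReal.ofReal (h t) ≤ K) :
    ∫⁻ t in Icc 0 T, F t ≤ ((B + 1) * K : ℝ≥0) := by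
  calc ∫⁻ t in Icc 0 T, F t
      ≤ ∫⁻ t in Icc 0 T, (B + 1 : ℝ≥0) * (F t / ENNReal.ofReal (h t)) := by
        refine setLIntegral_mono' measurableSet_Icc fun t ht => ?_
        calc F t = (B + 1 : ℝ≥0) * (F t / (B + 1 : ℝ≥0)) :=
              (ENNReal.mul_div_cancel (by simp) (by simp)).symm
          _ ≤ _ := by
              gcongr
              refine ENNReal.ofReal_le_of_le_toReal ((hB t ht).trans ?_)
              simp [ENNReal.toReal_add]
    _ = (B + 1 : ℝ≥0) * ∫⁻ t in Icc 0 T, F t / ENNReal.ofReal (h t) :=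
        lintegral_const_mul' _ _ (by simp)
    _ ≤ (B + 1 : ℝ≥0) * K := by gcongr
    _ = _ := by simp

/-- **Tonelli's theorem** for the action: sublevel sets are closed. -/
theorem isClosed_setOf_actionFn_le (hT : 0 < T) (x₀ : Euc d)
    (hlsc : LowerSemicontinuous fun p : Euc d × Euc d => L p.1 p.2)
    (hconv : ∀ (x u v : Euc d) (a b : ℝ≥0), a + b = 1 →
      L x (a • u + b • v) ≤ a * L x u + b * L x v)
    (hgrow : ∀ c : ℝ≥0, ∃ C : ℝ≥0, ∀ x u, c * ‖u‖ₑ ≤ L x u + C)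
    {B : ℝ≥0} (hB : ∀ t ∈ Icc 0 T, h t ≤ B)
    (hm : AEMeasurable h (volume.restrict (Icc 0 T))) (K : ℝ≥0) :
    IsClosed {φ | actionFn L h hT x₀ φ ≤ K} := by
  refine IsSeqClosed.isClosed fun φ ψ hφ hlim => ?_
  simp only [mem_ofPred_eq, actionFn_le_coe_iff] at hφ ⊢
  set F : ℕ → ℝ → Euc d := fun n => IccExtend hT.le (φ n) with hFdef
  set f : ℝ → Euc d := IccExtend hT.le ψ with hfdef
  have hunif : TendstoUniformly F f atTop :=
    ((ContinuousMap.tendsto_iff_tendstoUniformly).1 hlim).comp (projIcc 0 T hT.le)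
  have hFc : ∀ n, Continuous (F n) := fun n => (φ n).continuous.Icc_extend'
  have hfc : Continuous f := ψ.continuous.Icc_extend'
  have hAC : ∀ n, AbsolutelyContinuousOnInterval (F n) 0 T := fun n => (hφ n).1
  have hM : ∀ n, ∫⁻ t in Icc 0 T, L (F n t) (deriv (F n) t) ≤ ((B + 1) * K : ℝ≥0) := fun n =>
    setLIntegral_le_of_div_le hB (hφ n).2.2
  have hACf : AbsolutelyContinuousOnInterval f 0 T :=
    absolutelyContinuousOnInterval_of_tendsto hT.le hgrow hAC hM fun t => hunif.tendsto_at t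
  have hL : ∀ g : ℝ → Euc d, Continuous g → Measurable fun t => L (g t) (deriv g t) := fun g hg =>
    hlsc.measurable.comp (hg.measurable.prodMk (measurable_deriv g))
  have hw : ∀ g : ℝ → ℝ≥0∞, ∫⁻ t in Icc 0 T, g t / ENNReal.ofReal (h t) =
      ∫⁻ t in Icc 0 T, (ENNReal.ofReal (hm.mk h t))⁻¹ * g t := by
    intro g
    refine lintegral_congr_ae ?_
    filter_upwards [hm.ae_eq_mk] with t ht
    rw [ht, div_eq_mul_inv, mul_comm]
  refine ⟨hACf, ?_, ?_⟩
  · exact tendsto_nhds_unique (hunif.tendsto_at 0)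
      (tendsto_const_nhds.congr fun n => (hφ n).2.1.symm)
  · rw [hw]
    refine (lintegral_mul_le_liminf (hL f hfc) (fun n => hL (F n) (hFc n))
      (fun A hA => setLIntegral_action_le_liminf hT.le hlsc hconv hgrow hAC hM hACf hfc hunif hA)
      (hm.measurable_mk.ennreal_ofReal.inv)).trans ?_
    refine (liminf_le_liminf (v := fun _ => (K : ℝ≥0∞)) (Eventually.of_forall fun n => ?_)).trans
      (by simp)
    have := (hφ n).2.2
    rwa [hw] at this

/-- Sublevel sets of the action are compact: the superlinear growth of `L` makes them
equicontinuous. -/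
theorem isCompact_setOf_actionFn_le (hT : 0 < T) (x₀ : Euc d)
    (hlsc : LowerSemicontinuous fun p : Euc d × Euc d => L p.1 p.2)
    (hconv : ∀ (x u v : Euc d) (a b : ℝ≥0), a + b = 1 →
      L x (a • u + b • v) ≤ a * L x u + b * L x v)
    (hgrow : ∀ c : ℝ≥0, ∃ C : ℝ≥0, ∀ x u, c * ‖u‖ₑ ≤ L x u + C)
    {B : ℝ≥0} (hB : ∀ t ∈ Icc 0 T, h t ≤ B)
    (hm : AEMeasurable h (volume.restrict (Icc 0 T))) (K : ℝ≥0) :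
    IsCompact {φ | actionFn L h hT x₀ φ ≤ K} := by
  set M : ℝ≥0 := (B + 1) * K with hMdef
  have hmod : ∀ ε : ℝ≥0, 0 < ε → ∃ δ : ℝ≥0, 0 < δ ∧ ∀ φ, actionFn L h hT x₀ φ ≤ K →
      ∀ s t : Icc (0 : ℝ) T, dist s t ≤ δ → dist (φ s) (φ t) ≤ ε := by
    intro ε hε
    obtain ⟨δ, hδ, hδM⟩ := exists_uniform_setLIntegral_enorm_le hgrow M hε
    refine ⟨δ, hδ, fun φ hφ s t hst => ?_⟩
    rw [actionFn_le_coe_iff] at hφ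
    have h1 := edist_le_setLIntegral_deriv hT.le hφ.1 s.2 t.2
    rw [IccExtend_val, IccExtend_val] at h1
    have h2 := h1.trans (hδM _ _ _ (setLIntegral_le_of_div_le hB hφ.2.2) _
      ((Measure.restrict_le_self _).trans ?_))
    · rwa [edist_le_coe] at h2
    · simp only [uIoc, Real.volume_Ioc, max_sub_min_eq_abs']
      rw [ENNReal.ofReal_le_iff_le_toReal (by simp)]
      exact hst
  obtain ⟨δ, hδ, hδ1⟩ := hmod 1 one_pos
  obtain ⟨N, hN⟩ := exists_nat_gt (T / δ)
  -- chaining over steps of length at most `δ` bounds the paths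
  have hbound : ∀ φ, actionFn L h hT x₀ φ ≤ K → ∀ t, dist (φ t) x₀ ≤ N := by
    intro φ hφ t
    have hN0 : (0 : ℝ) < N := lt_of_le_of_lt (by positivity) hN
    have hstep : ∀ k : ℕ, k ≤ N → dist (IccExtend hT.le φ (k / N * t)) x₀ ≤ k := by
      intro k
      induction k with
      | zero =>
        intro _
        rw [Nat.cast_zero, zero_div, zero_mul, ((actionFn_le_coe_iff hT x₀ φ K).1 hφ).2.1,
          dist_self]
      | succ k ih =>
        intro hk
        have hmem : ∀ j : ℕ, j ≤ N → (j / N * t : ℝ) ∈ Icc 0 T := fun j hj => by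
          have h0 := t.2.1
          have h1 : (j / N : ℝ) ≤ 1 := div_le_one_of_le₀ (by exact_mod_cast hj) hN0.le
          exact ⟨by positivity, by nlinarith [t.2.2]⟩
        have h1 := hδ1 φ hφ ⟨_, hmem (k + 1) hk⟩ ⟨_, hmem k (by omega)⟩ ?_
        · rw [← IccExtend_of_mem hT.le φ, ← IccExtend_of_mem hT.le φ] at h1
          have h2 := dist_triangle (IccExtend hT.le φ ((k + 1 : ℕ) / N * t))
            (IccExtend hT.le φ (k / N * t)) x₀
          have h3 := ih (by omega)
          push_cast at h1 h2 ⊢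
          linarith
        · rw [Subtype.dist_eq, Real.dist_eq]
          have h4 : ((k + 1 : ℕ) / N * t - k / N * t : ℝ) = t / N := by push_cast; ring
          rw [h4, abs_of_nonneg (div_nonneg t.2.1 hN0.le), div_le_iff₀ hN0]
          have h5 : T < N * δ := by rwa [div_lt_iff₀ (by exact_mod_cast hδ)] at hN
          linarith [t.2.2]
    have := hstep N le_rfl
    rwa [div_self hN0.ne', one_mul, IccExtend_val] at this
  let e := ContinuousMap.isometryEquivBoundedOfCompact (Icc (0 : ℝ) T) (Euc d)
  rw [← e.toHomeomorph.isCompact_image]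
  refine BoundedContinuousFunction.arzela_ascoli₂ (Metric.closedBall x₀ N)
    (isCompact_closedBall _ _) _ ?_ ?_ ?_
  · exact e.toHomeomorph.isClosed_image.2
      (isClosed_setOf_actionFn_le hT x₀ hlsc hconv hgrow hB hm K)
  · rintro _ t ⟨φ, hφ, rfl⟩
    exact hbound φ hφ t
  · refine UniformEquicontinuous.equicontinuous (Metric.uniformEquicontinuous_iff.2 fun ε hε => ?_)
    lift ε to ℝ≥0 using hε.le
    obtain ⟨δ, hδ, hδε⟩ := hmod (ε / 2) (half_pos (by exact_mod_cast hε))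
    refine ⟨δ, by exact_mod_cast hδ, fun s t hst => ?_⟩
    rintro ⟨_, φ, hφ, rfl⟩
    refine (hδε φ hφ s t hst.le).trans_lt ?_
    rw [NNReal.coe_div]
    simpa using hε

theorem isRateFunction_of_isCompact {𝒳 : Type*} [TopologicalSpace 𝒳] [T2Space 𝒳] {I : 𝒳 → ℝ≥0∞}
    (hI : ∀ K : ℝ≥0, IsCompact {φ | I φ ≤ K}) : IsRateFunction I := by
  refine ⟨lowerSemicontinuous_iff_isClosed_preimage.2 fun K => ?_, hI⟩
  induction K with
  | top => simp
  | coe K => exact (hI K).isClosed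

end Action

/-! ### The limiting time scale -/

section TimeScale

variable {ε : ℕ → ℝ} {T : ℝ} {h : ℝ → ℝ}

theorem monotone_stepIndex (hsum : Tendsto (stepTime ε) atTop atTop) : Monotone (stepIndex ε) := by
  intro s t hst
  obtain ⟨N, hN⟩ := (hsum.eventually_gt_atTop t).exists_forall_of_atTop
  refine csSup_le_csSup' ⟨N, fun n hn => ?_⟩ fun n hn => le_trans hn hst
  by_contra hlt
  exact absurd (hN n (not_le.1 hlt).le) (not_lt.2 hn)

theorem measurable_stepRate (hsum : Tendsto (stepTime ε) atTop atTop) (n : ℕ) :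
    Measurable (stepRate ε T n) := by
  have h1 : Measurable (stepIndex ε) := (monotone_stepIndex hsum).measurable
  exact ((measurable_from_nat (f := ε)).comp
    (h1.comp (measurable_const.add measurable_id))).const_mul _

theorem aemeasurable_timeScale (hsum : Tendsto (stepTime ε) atTop atTop)
    (hlim : TendstoUniformlyOn (stepRate ε T) h atTop (Icc 0 T)) :
    AEMeasurable h (volume.restrict (Icc 0 T)) := by
  refine aemeasurable_of_tendsto_metrizable_ae atTop
    (fun n => (measurable_stepRate (T := T) hsum n).aemeasurable) ?_
  filter_upwards [ae_restrict_mem measurableSet_Icc] with t ht using hlim.tendsto_at ht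

/-- The limiting time scale is bounded above, since it is within `1` of some `h^n`, which takes
finitely many values. -/
theorem exists_timeScale_le (hsum : Tendsto (stepTime ε) atTop atTop)
    (hlim : TendstoUniformlyOn (stepRate ε T) h atTop (Icc 0 T)) :
    ∃ B : ℝ≥0, ∀ t ∈ Icc 0 T, h t ≤ B := by
  obtain ⟨n, hn⟩ := (Metric.tendstoUniformlyOn_iff.1 hlim 1 one_pos).exists
  have hnn : ∀ k, 0 ≤ |ε k| := fun k => abs_nonneg _
  refine ⟨Real.toNNReal (numSteps ε T n *
    (∑ k ∈ Finset.range (stepIndex ε (stepTime ε n + T) + 1), |ε k|) + 1), fun t ht => ?_⟩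
  have h1 := hn t ht
  rw [Real.dist_eq] at h1
  have h2 := (abs_lt.1 h1).2
  refine le_trans ?_ (Real.le_coe_toNNReal _)
  have h3 : stepRate ε T n t ≤ numSteps ε T n *
      (∑ k ∈ Finset.range (stepIndex ε (stepTime ε n + T) + 1), |ε k|) := by
    unfold stepRate
    gcongr
    refine (le_abs_self _).trans (Finset.single_le_sum (f := fun k => |ε k|) (fun k _ => hnn k) ?_)
    rw [Finset.mem_range, Nat.lt_succ_iff]
    exact monotone_stepIndex hsum (by linarith [ht.2])
  linarith

end TimeScale

/-! ### Dual characterisation of the relative entropy -/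

section Entropy

open InformationTheory BoundedContinuousFunction

/-- Young's inequality for the conjugate functions `klFun` and `exp - 1`. -/
theorem mul_le_klFun_add_exp_sub_one {a : ℝ} (ha : 0 ≤ a) (s : ℝ) :
    a * s ≤ klFun a + (Real.exp s - 1) := by
  rcases ha.eq_or_lt with rfl | ha
  · simp [klFun, Real.exp_nonneg]
  · have h1 := Real.add_one_le_exp (s - Real.log a)
    rw [Real.exp_sub, Real.exp_log ha, le_div_iff₀ ha] at h1
    rw [klFun]
    linarith

variable {S : Type*} [MeasurableSpace S] {π ν : Measure S}

/-- Young's inequality for the relative entropy and nonnegative test functions. -/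
theorem lintegral_ofReal_le_klDiv_add [IsFiniteMeasure π] [IsFiniteMeasure ν] {ψ : S → ℝ}
    (hψ : Measurable ψ) :
    ∫⁻ x, ENNReal.ofReal (ψ x) ∂π ≤
      klDiv π ν + ∫⁻ x, ENNReal.ofReal (Real.exp (ψ x) - 1) ∂ν := by
  by_cases hac : π ≪ ν
  swap
  · simp [klDiv_of_not_ac hac]
  rw [klDiv_eq_lintegral_klFun_of_ac hac, ← lintegral_add_right _ (by fun_prop),
    ← lintegral_rnDeriv_mul hac hψ.ennreal_ofReal.aemeasurable]
  refine lintegral_mono_ae ?_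
  filter_upwards [π.rnDeriv_lt_top ν] with x hx
  rcases le_total (ψ x) 0 with h | h
  · simp [ENNReal.ofReal_of_nonpos h]
  · nth_rewrite 1 [← ENNReal.ofReal_toReal hx.ne]
    rw [← ENNReal.ofReal_mul ENNReal.toReal_nonneg, ← ENNReal.ofReal_add
      (klFun_nonneg ENNReal.toReal_nonneg) (by simpa using h)]
    exact ENNReal.ofReal_le_ofReal (mul_le_klFun_add_exp_sub_one ENNReal.toReal_nonneg _)

theorem integrable_of_abs_le [IsFiniteMeasure π] {ψ : S → ℝ} (hψ : Measurable ψ) {M : ℝ}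
    (hM : ∀ x, |ψ x| ≤ M) : Integrable ψ π :=
  Integrable.of_bound hψ.aestronglyMeasurable M (Eventually.of_forall hM)

theorem integrable_exp_sub_one_of_abs_le [IsFiniteMeasure π] {ψ : S → ℝ} (hψ : Measurable ψ)
    {M : ℝ} (hM : ∀ x, |ψ x| ≤ M) : Integrable (fun x => Real.exp (ψ x) - 1) π := by
  refine (Integrable.of_bound (by fun_prop) (Real.exp M) (Eventually.of_forall fun x => ?_)).sub
    (integrable_const 1)
  rw [Real.norm_eq_abs, Real.abs_exp]
  exact Real.exp_le_exp.2 ((le_abs_self _).trans (hM x))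

/-- Young's inequality for the relative entropy and bounded test functions. -/
theorem integral_le_klDiv_add [IsFiniteMeasure π] [IsFiniteMeasure ν] (hfin : klDiv π ν ≠ ⊤)
    {ψ : S → ℝ} (hψ : Measurable ψ) {M : ℝ} (hM : ∀ x, |ψ x| ≤ M) :
    ∫ x, ψ x ∂π ≤ (klDiv π ν).toReal + ∫ x, (Real.exp (ψ x) - 1) ∂ν := by
  obtain ⟨hac, hint⟩ := klDiv_ne_top_iff.1 hfin
  rw [toReal_klDiv_eq_integral_klFun hac, ← integral_rnDeriv_smul hac,
    ← integral_add ((integrable_klFun_rnDeriv_iff hac).2 hint)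
      (integrable_exp_sub_one_of_abs_le hψ hM)]
  refine integral_mono ((integrable_rnDeriv_smul_iff hac).2 (integrable_of_abs_le hψ hM))
    (((integrable_klFun_rnDeriv_iff hac).2 hint).add (integrable_exp_sub_one_of_abs_le hψ hM))
    fun x => ?_
  exact mul_le_klFun_add_exp_sub_one ENNReal.toReal_nonneg _

theorem abs_exp_sub_exp_le {a b M : ℝ} (ha : |a| ≤ M) (hb : |b| ≤ M) :
    |Real.exp a - Real.exp b| ≤ Real.exp M * |a - b| := by
  wlog hab : b ≤ a generalizing a b
  · rw [abs_sub_comm, abs_sub_comm a]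
    exact this hb ha (not_le.1 hab).le
  rw [abs_of_nonneg (by simpa using hab), abs_of_nonneg (by linarith)]
  have h1 := Real.add_one_le_exp (b - a)
  have h2 : Real.exp b = Real.exp a * Real.exp (b - a) := by rw [← Real.exp_add]; ring_nf
  have h3 : Real.exp a ≤ Real.exp M := Real.exp_le_exp.2 ((le_abs_self _).trans ha)
  have h4 : Real.exp a * (a - b) ≤ Real.exp M * (a - b) := by gcongr
  nlinarith [Real.exp_pos a]

variable [TopologicalSpace S] [TopologicalSpace.PseudoMetrizableSpace S] [BorelSpace S]

/-- The dual inequality extends from bounded continuous to bounded measurable functions. -/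
theorem integral_le_of_forall_boundedContinuous [IsFiniteMeasure π] [IsFiniteMeasure ν] {c : ℝ}
    (hdual : ∀ ψ : S →ᵇ ℝ, ∫ x, ψ x ∂π ≤ c + ∫ x, (Real.exp (ψ x) - 1) ∂ν)
    {ψ : S → ℝ} (hψ : Measurable ψ) {M : ℝ} (hM : ∀ x, |ψ x| ≤ M) :
    ∫ x, ψ x ∂π ≤ c + ∫ x, (Real.exp (ψ x) - 1) ∂ν := by
  rcases isEmpty_or_nonempty S with hS | ⟨⟨x₀⟩⟩
  · simpa [Measure.eq_zero_of_isEmpty] using hdual 0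
  have hM0 : 0 ≤ M := (abs_nonneg _).trans (hM x₀)
  refine le_of_forall_pos_le_add fun ε hε => ?_
  set δ : ℝ := ε / (1 + Real.exp M) with hδ
  have hδ0 : 0 < δ := by positivity
  obtain ⟨φ, hφ, -⟩ := (integrable_of_abs_le
    (π := π + ν) hψ hM).exists_boundedContinuous_integral_sub_le hδ0
  -- clamping the approximation to `[-M, M]` does not increase the error
  set θ : S →ᵇ ℝ := BoundedContinuousFunction.ofNormedAddCommGroup
    (fun x => max (-M) (min M (φ x))) (by fun_prop) M (fun x => by
      rw [Real.norm_eq_abs, abs_le]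
      exact ⟨le_max_left _ _, max_le (by linarith) (min_le_left _ _)⟩) with hθ
  have hθv : ∀ x, θ x = max (-M) (min M (φ x)) := fun x => rfl
  have hθM : ∀ x, |θ x| ≤ M := fun x => by
    rw [hθv, abs_le]
    exact ⟨le_max_left _ _, max_le (by linarith) (min_le_left _ _)⟩
  have hθm : Measurable θ := θ.continuous.measurable
  have hclose : ∀ x, |ψ x - θ x| ≤ |ψ x - φ x| := fun x => by
    have h1 := abs_le.1 (hM x)
    rw [hθv]
    rcases le_total M (φ x) with h | h
    · rw [min_eq_left h, max_eq_right (by linarith), abs_sub_comm, abs_sub_comm (ψ x),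
        abs_of_nonneg (by linarith), abs_of_nonneg (by linarith)]
      linarith
    · rw [min_eq_right h]
      rcases le_total (-M) (φ x) with h' | h'
      · rw [max_eq_right h']
      · rw [max_eq_left h', abs_of_nonneg (by linarith), abs_of_nonneg (by linarith)]
        linarith
  have hint : ∀ κ : Measure S, IsFiniteMeasure κ → κ ≤ π + ν → ∫ x, |ψ x - θ x| ∂κ ≤ δ := by
    intro κ _ hκ
    have hi : Integrable (fun x => ψ x - φ x) (π + ν) :=
      (integrable_of_abs_le hψ hM).sub (φ.integrable _)
    calc ∫ x, |ψ x - θ x| ∂κ ≤ ∫ x, |ψ x - φ x| ∂κ :=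
          integral_mono ((integrable_of_abs_le hψ hM).sub (θ.integrable _)).abs
            (hi.mono_measure hκ).abs hclose
      _ ≤ ∫ x, |ψ x - φ x| ∂(π + ν) :=
          integral_mono_measure hκ (Eventually.of_forall fun x => abs_nonneg _) hi.abs
      _ ≤ δ := hφ
  have h1 : ∫ x, ψ x ∂π ≤ ∫ x, θ x ∂π + δ := by
    have := hint π inferInstance (Measure.le_add_right le_rfl)
    have h2 : ∫ x, ψ x ∂π - ∫ x, θ x ∂π ≤ ∫ x, |ψ x - θ x| ∂π := by
      rw [← integral_sub (integrable_of_abs_le hψ hM) (θ.integrable _)]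
      exact (le_abs_self _).trans abs_integral_le_integral_abs
    linarith
  have h2 : ∫ x, (Real.exp (θ x) - 1) ∂ν ≤ ∫ x, (Real.exp (ψ x) - 1) ∂ν + Real.exp M * δ := by
    have h3 := hint ν inferInstance (Measure.le_add_left le_rfl)
    have h4 : ∫ x, (Real.exp (θ x) - 1) ∂ν - ∫ x, (Real.exp (ψ x) - 1) ∂ν ≤
        ∫ x, Real.exp M * |ψ x - θ x| ∂ν := by
      rw [← integral_sub (integrable_exp_sub_one_of_abs_le hθm hθM)
        (integrable_exp_sub_one_of_abs_le hψ hM)]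
      refine integral_mono ((integrable_exp_sub_one_of_abs_le hθm hθM).sub
        (integrable_exp_sub_one_of_abs_le hψ hM))
        (((integrable_of_abs_le hψ hM).sub (θ.integrable _)).abs.const_mul _) fun x => ?_
      have := (le_abs_self _).trans (abs_exp_sub_exp_le (hθM x) (hM x))
      rw [abs_sub_comm (ψ x)]
      linarith
    rw [integral_const_mul] at h4
    nlinarith [Real.exp_pos M]
  have h3 : δ + Real.exp M * δ = ε := by rw [hδ]; field_simp
  linarith [hdual θ]

/-- The dual characterisation of the relative entropy by bounded continuous functions. -/
theorem klDiv_le_of_forall_boundedContinuous [IsFiniteMeasure π] [IsFiniteMeasure ν] {c : ℝ}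
    (hdual : ∀ ψ : S →ᵇ ℝ, ∫ x, ψ x ∂π ≤ c + ∫ x, (Real.exp (ψ x) - 1) ∂ν) :
    π ≪ ν ∧ klDiv π ν ≤ ENNReal.ofReal c := by
  have hac : π ≪ ν := by
    refine Measure.AbsolutelyContinuous.mk fun A hA hνA => ?_
    have h1 : ∀ k : ℕ, (k : ℝ) * π.real A ≤ c := by
      intro k
      have h2 := integral_le_of_forall_boundedContinuous hdual
        (ψ := A.indicator fun _ => (k : ℝ)) (measurable_const.indicator hA) (M := k) fun x => by
          by_cases hx : x ∈ A <;> simp [hx]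
      have h3 : ∫ x, (Real.exp (A.indicator (fun _ => (k : ℝ)) x) - 1) ∂ν = 0 := by
        refine integral_eq_zero_of_ae ?_
        filter_upwards [measure_eq_zero_iff_ae_notMem.1 hνA] with x hx
        simp [hx]
      rw [h3, integral_indicator_const _ hA] at h2
      simpa [mul_comm] using h2
    have h2 : π.real A ≤ 0 := by
      by_contra hpos
      push Not at hpos
      obtain ⟨k, hk⟩ := exists_nat_gt (c / π.real A)
      rw [div_lt_iff₀ hpos] at hk
      exact absurd (h1 k) (not_le.2 hk)
    rw [← measureReal_eq_zero_iff]
    exact le_antisymm h2 measureReal_nonneg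
  refine ⟨hac, ?_⟩
  rw [klDiv_eq_lintegral_klFun_of_ac hac]
  set f : S → ℝ := fun x => (π.rnDeriv ν x).toReal with hf
  have hfm : Measurable f := (π.measurable_rnDeriv ν).ennreal_toReal
  have hf0 : ∀ x, 0 ≤ f x := fun x => ENNReal.toReal_nonneg
  -- the optimal test function is `log f`; it is approximated by `log (m k)`, with `m k` bounded
  -- away from `0` and `∞`
  set m : ℕ → S → ℝ := fun k x => max ((k : ℝ) + 1)⁻¹ (min (k + 1) (f x)) with hm
  have hinv : ∀ k : ℕ, ((k : ℝ) + 1)⁻¹ ≤ 1 := fun k => inv_le_one_of_one_le₀ (by simp)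
  have hm1 : ∀ (k : ℕ) x, ((k : ℝ) + 1)⁻¹ ≤ m k x := fun k x => le_max_left _ _
  have hm0 : ∀ (k : ℕ) x, 0 < m k x := fun k x => lt_of_lt_of_le (by positivity) (hm1 k x)
  have hm2 : ∀ (k : ℕ) x, m k x ≤ k + 1 := fun k x =>
    max_le ((hinv k).trans (by simp)) (min_le_left _ _)
  have hmm : ∀ k, Measurable (m k) := fun k => by fun_prop
  have hlogb : ∀ (k : ℕ) x, |Real.log (m k x)| ≤ Real.log (k + 1) := fun k x => by
    rw [abs_le, ← Real.log_inv]
    exact ⟨Real.log_le_log (by positivity) (hm1 k x), Real.log_le_log (hm0 k x) (hm2 k x)⟩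
  have hlogm : ∀ k, Measurable fun x => Real.log (m k x) := fun k => (hmm k).log
  have hnn : ∀ (k : ℕ) x, 0 ≤ f x * Real.log (m k x) - (m k x - 1) := by
    intro k x
    have h1 := klFun_nonneg (hm0 k x).le
    rw [klFun] at h1
    have h2 : m k x * Real.log (m k x) ≤ f x * Real.log (m k x) := by
      rcases le_total 1 (f x) with h | h
      · have h3 : m k x ≤ f x := max_le ((hinv k).trans h) (min_le_right _ _)
        have h4 : 1 ≤ m k x := (le_min (by simp) h).trans (le_max_right _ _)
        exact mul_le_mul_of_nonneg_right h3 (Real.log_nonneg h4)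
      · have h3 : f x ≤ m k x :=
          (le_min (h.trans (by simp)) le_rfl).trans (le_max_right _ _)
        have h4 : m k x ≤ 1 := max_le (hinv k) ((min_le_right _ _).trans h)
        exact mul_le_mul_of_nonpos_right h3 (Real.log_nonpos (hm0 k x).le h4)
    linarith
  have hlim : ∀ x, Tendsto (fun k : ℕ => f x * Real.log (m k x) - (m k x - 1)) atTop
      (𝓝 (klFun (f x))) := by
    intro x
    have h1 : Tendsto (fun k : ℕ => m k x) atTop (𝓝 (f x)) := by
      have h2 : Tendsto (fun k : ℕ => max ((k : ℝ) + 1)⁻¹ (f x)) atTop (𝓝 (max 0 (f x))) :=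
        (by simpa using tendsto_one_div_add_atTop_nhds_zero_nat (𝕜 := ℝ) :
          Tendsto (fun k : ℕ => ((k : ℝ) + 1)⁻¹) atTop (𝓝 0)).max tendsto_const_nhds
      rw [max_eq_right (hf0 x)] at h2
      refine h2.congr' ?_
      obtain ⟨K, hK⟩ := exists_nat_gt (f x)
      filter_upwards [eventually_ge_atTop K] with k hk
      have : f x ≤ k + 1 := by
        have : (K : ℝ) ≤ k := by exact_mod_cast hk
        linarith
      simp only [hm, min_eq_right this]
    have h3 : klFun (f x) = f x * Real.log (f x) - (f x - 1) := by rw [klFun]; ring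
    rw [h3]
    refine Tendsto.sub ?_ (h1.sub_const 1)
    rcases (hf0 x).eq_or_lt with h0 | h0
    · simp [← h0]
    · exact (h1.log h0.ne').const_mul _
  have hbound : ∀ k : ℕ, ∫⁻ x, ENNReal.ofReal (f x * Real.log (m k x) - (m k x - 1)) ∂ν ≤
      ENNReal.ofReal c := by
    intro k
    have h1 := integral_le_of_forall_boundedContinuous hdual (hlogm k) (hlogb k)
    have h2 : Integrable (fun x => f x * Real.log (m k x)) ν :=
      (integrable_rnDeriv_smul_iff hac).2 (integrable_of_abs_le (hlogm k) (hlogb k))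
    have h3 := integrable_exp_sub_one_of_abs_le (π := ν) (hlogm k) (hlogb k)
    rw [← integral_rnDeriv_smul hac] at h1
    simp_rw [fun x => Real.exp_log (hm0 k x)] at h1 h3
    have h4 : Integrable (fun x => f x * Real.log (m k x) - (m k x - 1)) ν := h2.sub h3
    rw [← ofReal_integral_eq_lintegral_ofReal h4 (Eventually.of_forall (hnn k)),
      integral_sub h2 h3]
    refine ENNReal.ofReal_le_ofReal ?_
    simp only [smul_eq_mul] at h1
    linarith
  calc ∫⁻ x, ENNReal.ofReal (klFun (f x)) ∂ν
      = ∫⁻ x, liminf (fun k : ℕ =>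
          ENNReal.ofReal (f x * Real.log (m k x) - (m k x - 1))) atTop ∂ν :=
        lintegral_congr fun x => ((ENNReal.tendsto_ofReal (hlim x)).liminf_eq).symm
    _ ≤ liminf (fun k : ℕ =>
          ∫⁻ x, ENNReal.ofReal (f x * Real.log (m k x) - (m k x - 1)) ∂ν) atTop :=
        lintegral_liminf_le fun k => by fun_prop
    _ ≤ liminf (fun _ : ℕ => ENNReal.ofReal c) atTop :=
        liminf_le_liminf (Eventually.of_forall hbound)
    _ = ENNReal.ofReal c := by simp

end Entropy

/-! ### Exponential moments -/

section ExponentialMoments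

theorem exists_norm_le_card_mul_abs {d : ℕ} [NeZero d] (v : Euc d) :
    ∃ i, ‖v‖ ≤ d * |v i| := by
  obtain ⟨i, hi⟩ := Finite.exists_max fun i => |v i|
  refine ⟨i, ?_⟩
  have hd : (1 : ℝ) ≤ d := by exact_mod_cast NeZero.one_le
  rw [EuclideanSpace.norm_eq]
  refine Real.sqrt_le_iff.2 ⟨by positivity, ?_⟩
  calc ∑ j, ‖v j‖ ^ 2 ≤ ∑ _j : Fin d, |v i| ^ 2 := by
        refine Finset.sum_le_sum fun j _ => ?_
        rw [Real.norm_eq_abs]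
        exact pow_le_pow_left₀ (abs_nonneg _) (hi j) 2
    _ = d * |v i| ^ 2 := by simp
    _ ≤ (d * |v i|) ^ 2 := by
        nlinarith [sq_nonneg (v i), sq_abs (v i),
          mul_nonneg (sub_nonneg.2 hd) (sq_nonneg (v i))]

/-- Exponential moments in the coordinate directions control those of the norm. -/
theorem ofReal_exp_norm_le {d : ℕ} {c : ℝ} (hc : 0 ≤ c) (v : Euc d) :
    ENNReal.ofReal (Real.exp (c * ‖v‖)) ≤
      1 + ∑ i, (ENNReal.ofReal (Real.exp (inner ℝ (EuclideanSpace.single i (c * d)) v)) +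
        ENNReal.ofReal (Real.exp (inner ℝ (EuclideanSpace.single i (-(c * d))) v))) := by
  rcases Nat.eq_zero_or_pos d with rfl | hd
  · simp [Subsingleton.elim v 0]
  have : NeZero d := ⟨hd.ne'⟩
  obtain ⟨i, hi⟩ := exists_norm_le_card_mul_abs v
  refine le_trans ?_ le_add_self
  refine le_trans ?_ (Finset.single_le_sum (fun _ _ => zero_le) (Finset.mem_univ i))
  have h1 : c * ‖v‖ ≤ c * (d * |v i|) := by gcongr
  rcases abs_cases (v i) with ⟨h, -⟩ | ⟨h, -⟩
  · refine le_trans ?_ le_self_add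
    refine ENNReal.ofReal_le_ofReal (Real.exp_le_exp.2 (h1.trans_eq ?_))
    rw [h, EuclideanSpace.inner_single_left]
    simp; ring
  · refine le_trans ?_ le_add_self
    refine ENNReal.ofReal_le_ofReal (Real.exp_le_exp.2 (h1.trans_eq ?_))
    rw [h, EuclideanSpace.inner_single_left]
    simp; ring

theorem exists_lintegral_exp_norm_le {ι α : Type*} [MeasurableSpace α] {d : ℕ} {κ : ι → Measure α}
    [∀ i, IsProbabilityMeasure (κ i)] {v : ι → α → Euc d} (hvm : ∀ i, Measurable (v i))
    (hv : ∀ u : Euc d, ∃ C : ℝ≥0, ∀ i,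
      ∫⁻ z, ENNReal.ofReal (Real.exp (inner ℝ u (v i z))) ∂(κ i) ≤ C) (c : ℝ≥0) :
    ∃ C : ℝ≥0, ∀ i, ∫⁻ z, ENNReal.ofReal (Real.exp (c * ‖v i z‖)) ∂(κ i) ≤ C := by
  choose C hC using hv
  refine ⟨1 + ∑ j, (C (EuclideanSpace.single j (c * d)) + C (EuclideanSpace.single j (-(c * d)))),
    fun i => ?_⟩
  refine (lintegral_mono fun z => ofReal_exp_norm_le c.2 (v i z)).trans ?_
  rw [lintegral_add_left measurable_const, lintegral_finsetSum _ fun j _ => by fun_prop]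
  push_cast
  refine add_le_add (by simp) (Finset.sum_le_sum fun j _ => ?_)
  rw [lintegral_add_left (by fun_prop)]
  exact add_le_add (hC _ i) (hC _ i)

/-- The exponential moment hypothesis, rewritten as a uniform bound on the exponential integrals. -/
theorem exists_lintegral_exp_inner_le {E α : Type*} [MeasurableSpace α] {d : ℕ}
    {κ : E → α → Measure α} {v : E → α → Euc d} {u : Euc d}
    (h : (⨆ x, ⨆ y, logMGF (κ x y) fun z => inner ℝ u (v x z)) < ⊤) :
    ∃ C : ℝ≥0, ∀ p : E × α,
      ∫⁻ z, ENNReal.ofReal (Real.exp (inner ℝ u (v p.1 z))) ∂(κ p.1 p.2) ≤ C := by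
  set s := ⨆ x, ⨆ y, logMGF (κ x y) fun z => inner ℝ u (v x z) with hs
  have hfin : EReal.exp s ≠ ⊤ := by simpa using h.ne
  refine ⟨(EReal.exp s).toNNReal, fun p => ?_⟩
  rw [ENNReal.coe_toNNReal hfin, ← ENNReal.exp_log (∫⁻ z, _ ∂_)]
  exact EReal.exp_monotone (le_iSup₂ (f := fun x y => logMGF (κ x y) fun z => inner ℝ u (v x z))
    p.1 p.2)

end ExponentialMoments

/-! ### Growth and convexity of the local rate -/

section LocalRate

open InformationTheory BoundedContinuousFunction

variable {d₁ d₂ : ℕ} {g : Euc d₁ → Euc d₂ → Euc d₁} {ρ : Euc d₁ → Kernel (Euc d₂) (Euc d₂)}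

theorem exists_coupling_of_localRate_lt {x β : Euc d₁} {K : ℝ≥0∞} (h : localRate g ρ x β < K) :
    ∃ (μ : Measure (Euc d₂)) (γ : Measure (Euc d₂ × Euc d₂)), IsProbabilityMeasure μ ∧
      Integrable (g x) μ ∧ β = ∫ z, g x z ∂μ ∧ γ ∈ couplings μ ∧ klDiv γ (μ ⊗ₘ ρ x) < K := by
  simp only [localRate, iInf_lt_iff] at h
  obtain ⟨μ, hμ, hint, hβ, γ, hγ, hK⟩ := h
  exact ⟨μ, γ, hμ, hint, hβ, hγ, hK⟩

theorem localRate_le {x β : Euc d₁} {μ : Measure (Euc d₂)} {γ : Measure (Euc d₂ × Euc d₂)}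
    (hμ : IsProbabilityMeasure μ) (hint : Integrable (g x) μ) (hβ : β = ∫ z, g x z ∂μ)
    (hγ : γ ∈ couplings μ) : localRate g ρ x β ≤ klDiv γ (μ ⊗ₘ ρ x) := by
  simp only [localRate]
  exact iInf_le_of_le μ <| iInf_le_of_le hμ <| iInf_le_of_le hint <| iInf_le_of_le hβ <|
    iInf₂_le γ hγ

theorem lintegral_fst_of_mem_couplings {α : Type*} [MeasurableSpace α] {μ : Measure α}
    {γ : Measure (α × α)} (hγ : γ ∈ couplings μ) {f : α → ℝ≥0∞} (hf : Measurable f) :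
    ∫⁻ p, f p.1 ∂γ = ∫⁻ y, f y ∂μ := by
  rw [← hγ.2.1, Measure.fst, lintegral_map hf measurable_fst]

theorem lintegral_snd_of_mem_couplings {α : Type*} [MeasurableSpace α] {μ : Measure α}
    {γ : Measure (α × α)} (hγ : γ ∈ couplings μ) {f : α → ℝ≥0∞} (hf : Measurable f) :
    ∫⁻ p, f p.2 ∂γ = ∫⁻ y, f y ∂μ := by
  rw [← hγ.2.2, Measure.snd, lintegral_map hf measurable_snd]

variable [∀ x, IsMarkovKernel (ρ x)]

/-- Young's inequality for the second marginal of a coupling: exponential moments under the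
transition kernel control moments under the coupling. -/
theorem lintegral_ofReal_le_klDiv_add_of_mem_couplings {x : Euc d₁} {μ : Measure (Euc d₂)}
    [IsProbabilityMeasure μ] {γ : Measure (Euc d₂ × Euc d₂)} (hγ : γ ∈ couplings μ)
    {ψ : Euc d₂ → ℝ} (hψ : Measurable ψ) {C : ℝ≥0∞}
    (hC : ∀ y, ∫⁻ z, ENNReal.ofReal (Real.exp (ψ z) - 1) ∂(ρ x y) ≤ C) :
    ∫⁻ z, ENNReal.ofReal (ψ z) ∂μ ≤ klDiv γ (μ ⊗ₘ ρ x) + C := by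
  have := hγ.1
  rw [← lintegral_snd_of_mem_couplings hγ hψ.ennreal_ofReal]
  refine (lintegral_ofReal_le_klDiv_add (ν := μ ⊗ₘ ρ x) (hψ.comp measurable_snd)).trans ?_
  gcongr
  simp only [Function.comp_apply]
  rw [Measure.lintegral_compProd (by fun_prop)]
  exact (lintegral_mono hC).trans (by simp)

theorem lintegral_ofReal_norm_le {x : Euc d₁} {μ : Measure (Euc d₂)}
    [IsProbabilityMeasure μ] {γ : Measure (Euc d₂ × Euc d₂)} (hγ : γ ∈ couplings μ) {d : ℕ}
    {v : Euc d₂ → Euc d} (hv : Measurable v) {c : ℝ} {C : ℝ≥0}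
    (hC : ∀ y, ∫⁻ z, ENNReal.ofReal (Real.exp (c * ‖v z‖)) ∂(ρ x y) ≤ C) :
    ∫⁻ z, ENNReal.ofReal (c * ‖v z‖) ∂μ ≤ klDiv γ (μ ⊗ₘ ρ x) + C :=
  lintegral_ofReal_le_klDiv_add_of_mem_couplings hγ (by fun_prop) fun y =>
    (lintegral_mono fun z => ENNReal.ofReal_le_ofReal (sub_le_self _ zero_le_one)).trans (hC y)

/-- Superlinear growth of the local rate, uniformly in the state, from the exponential moments
of `g`. -/
theorem localRate_superlinear (hgm : ∀ x, Measurable (g x))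
    (hg : ∀ c : ℝ≥0, ∃ C : ℝ≥0, ∀ x y, ∫⁻ z, ENNReal.ofReal (Real.exp (c * ‖g x z‖)) ∂(ρ x y) ≤ C)
    (c : ℝ≥0) : ∃ C : ℝ≥0, ∀ x β, c * ‖β‖ₑ ≤ localRate g ρ x β + C := by
  obtain ⟨C, hC⟩ := hg c
  refine ⟨C, fun x β => ?_⟩
  refine tsub_le_iff_right.1 (le_of_forall_gt fun K hK => ?_)
  obtain ⟨μ, γ, hμ, hint, rfl, hγ, hlt⟩ := exists_coupling_of_localRate_lt hK
  refine lt_of_le_of_lt (tsub_le_iff_right.2 ?_) hlt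
  refine le_trans ?_ (lintegral_ofReal_norm_le hγ (hgm x) (hC x))
  calc c * ‖∫ z, g x z ∂μ‖ₑ ≤ c * ∫⁻ z, ‖g x z‖ₑ ∂μ := by
        gcongr; exact enorm_integral_le_lintegral_enorm _
    _ = ∫⁻ z, c * ‖g x z‖ₑ ∂μ := (lintegral_const_mul' _ _ (by simp)).symm
    _ = _ := by
        refine lintegral_congr fun z => ?_
        rw [ENNReal.ofReal_mul c.coe_nonneg, ofReal_norm]
        simp

theorem couplings_convex {α : Type*} [MeasurableSpace α] {μ₀ μ₁ : Measure α}
    {γ₀ γ₁ : Measure (α × α)} (h₀ : γ₀ ∈ couplings μ₀) (h₁ : γ₁ ∈ couplings μ₁) {a b : ℝ≥0}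
    (hab : a + b = 1) : a • γ₀ + b • γ₁ ∈ couplings (a • μ₀ + b • μ₁) := by
  obtain ⟨hp₀, h₀1, h₀2⟩ := h₀
  obtain ⟨hp₁, h₁1, h₁2⟩ := h₁
  refine ⟨⟨?_⟩, ?_, ?_⟩
  · simp only [Measure.coe_add, Measure.coe_nnreal_smul_apply, Pi.add_apply, measure_univ, mul_one]
    exact_mod_cast hab
  · rw [Measure.fst, Measure.map_add _ _ measurable_fst, Measure.map_smul, Measure.map_smul]
    rw [← h₀1, ← h₁1]; rfl
  · rw [Measure.snd, Measure.map_add _ _ measurable_snd, Measure.map_smul, Measure.map_smul]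
    rw [← h₀2, ← h₁2]; rfl

theorem isProbabilityMeasure_convex {α : Type*} [MeasurableSpace α] {μ₀ μ₁ : Measure α}
    [IsProbabilityMeasure μ₀] [IsProbabilityMeasure μ₁] {a b : ℝ≥0} (hab : a + b = 1) :
    IsProbabilityMeasure (a • μ₀ + b • μ₁) := by
  refine ⟨?_⟩
  simp only [Measure.coe_add, Measure.coe_nnreal_smul_apply, Pi.add_apply, measure_univ, mul_one]
  exact_mod_cast hab

/-- Joint convexity of the relative entropy, from its dual characterisation. -/
theorem klDiv_convex {S : Type*} [MeasurableSpace S] [TopologicalSpace S]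
    [TopologicalSpace.PseudoMetrizableSpace S] [BorelSpace S] {π₀ π₁ ν₀ ν₁ : Measure S}
    [IsFiniteMeasure π₀] [IsFiniteMeasure π₁] [IsFiniteMeasure ν₀] [IsFiniteMeasure ν₁]
    (h₀ : klDiv π₀ ν₀ ≠ ⊤) (h₁ : klDiv π₁ ν₁ ≠ ⊤) (a b : ℝ≥0) :
    klDiv (a • π₀ + b • π₁) (a • ν₀ + b • ν₁) ≤ a * klDiv π₀ ν₀ + b * klDiv π₁ ν₁ := by
  have hc : a * klDiv π₀ ν₀ + b * klDiv π₁ ν₁ =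
      ENNReal.ofReal (a * (klDiv π₀ ν₀).toReal + b * (klDiv π₁ ν₁).toReal) := by
    rw [ENNReal.ofReal_add (by positivity) (by positivity), ENNReal.ofReal_mul (by positivity),
      ENNReal.ofReal_mul (by positivity), ENNReal.ofReal_toReal h₀, ENNReal.ofReal_toReal h₁]
    simp
  rw [hc]
  refine (klDiv_le_of_forall_boundedContinuous fun ψ => ?_).2
  have hψm : Measurable ψ := ψ.continuous.measurable
  have hψM : ∀ x, |ψ x| ≤ ‖ψ‖ := ψ.norm_coe_le_norm
  have hexp : ∀ κ : Measure S, IsFiniteMeasure κ → Integrable (fun x => Real.exp (ψ x) - 1) κ :=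
    fun κ _ => integrable_exp_sub_one_of_abs_le hψm hψM
  rw [integral_add_measure (ψ.integrable _) (ψ.integrable _),
    integral_add_measure (hexp _ inferInstance) (hexp _ inferInstance),
    integral_smul_nnreal_measure, integral_smul_nnreal_measure, integral_smul_nnreal_measure,
    integral_smul_nnreal_measure]
  simp only [NNReal.smul_def, smul_eq_mul]
  have h2 := mul_le_mul_of_nonneg_left (integral_le_klDiv_add h₀ hψm hψM) a.2
  have h3 := mul_le_mul_of_nonneg_left (integral_le_klDiv_add h₁ hψm hψM) b.2
  simp only [NNReal.val_eq_coe] at h2 h3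
  linarith

theorem localRate_convex (x β₀ β₁ : Euc d₁) (a b : ℝ≥0) (hab : a + b = 1) :
    localRate g ρ x (a • β₀ + b • β₁) ≤ a * localRate g ρ x β₀ + b * localRate g ρ x β₁ := by
  rcases eq_or_ne a 0 with rfl | ha
  · simp only [zero_add] at hab; simp [hab]
  rcases eq_or_ne b 0 with rfl | hb
  · simp only [add_zero] at hab; simp [hab]
  by_cases h₀ : localRate g ρ x β₀ = ⊤
  · simp [h₀, ha]
  by_cases h₁ : localRate g ρ x β₁ = ⊤
  · simp [h₁, hb]
  refine ENNReal.le_of_forall_pos_le_add fun ε hε _ => ?_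
  have hε' : (ε : ℝ≥0∞) ≠ 0 := by simpa using hε.ne'
  obtain ⟨μ₀, γ₀, hμ₀, hint₀, rfl, hγ₀, hlt₀⟩ :=
    exists_coupling_of_localRate_lt (ENNReal.lt_add_right h₀ hε')
  obtain ⟨μ₁, γ₁, hμ₁, hint₁, rfl, hγ₁, hlt₁⟩ :=
    exists_coupling_of_localRate_lt (ENNReal.lt_add_right h₁ hε')
  have hp₀ := hγ₀.1
  have hp₁ := hγ₁.1
  have hcomp : (a • μ₀ + b • μ₁) ⊗ₘ ρ x = a • (μ₀ ⊗ₘ ρ x) + b • (μ₁ ⊗ₘ ρ x) := by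
    rw [Measure.compProd_add_left]
    congr 1 <;> exact Measure.compProd_smul_left _
  have hi₀ : Integrable (g x) (a • μ₀) := hint₀.smul_measure_nnreal
  have hi₁ : Integrable (g x) (b • μ₁) := hint₁.smul_measure_nnreal
  calc localRate g ρ x (a • ∫ z, g x z ∂μ₀ + b • ∫ z, g x z ∂μ₁)
      ≤ klDiv (a • γ₀ + b • γ₁) ((a • μ₀ + b • μ₁) ⊗ₘ ρ x) := by
        refine localRate_le (isProbabilityMeasure_convex hab) (hi₀.add_measure hi₁) ?_
          (couplings_convex hγ₀ hγ₁ hab)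
        rw [integral_add_measure hi₀ hi₁, integral_smul_nnreal_measure,
          integral_smul_nnreal_measure]
    _ ≤ a * klDiv γ₀ (μ₀ ⊗ₘ ρ x) + b * klDiv γ₁ (μ₁ ⊗ₘ ρ x) := by
        rw [hcomp]
        exact klDiv_convex hlt₀.ne_top hlt₁.ne_top a b
    _ ≤ a * (localRate g ρ x (∫ z, g x z ∂μ₀) + ε) +
        b * (localRate g ρ x (∫ z, g x z ∂μ₁) + ε) := by
        gcongr
    _ = a * localRate g ρ x (∫ z, g x z ∂μ₀) + b * localRate g ρ x (∫ z, g x z ∂μ₁) +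
        ((a + b : ℝ≥0) : ℝ≥0∞) * ε := by push_cast; ring
    _ = _ := by rw [hab]; simp

end LocalRate

/-! ### Continuity of integrals in the density -/

section Feller

variable {α : Type*} [MeasurableSpace α]

/-- If probability densities converge pointwise, then so do the integrals of uniformly bounded
functions that converge pointwise: Fatou's lemma for `M + F n` and for `M - F n`. -/
theorem tendsto_integral_withDensity {lam : Measure α} {e : ℕ → α → ℝ} {e₀ : α → ℝ}
    (hem : ∀ n, Measurable (e n)) (he₀m : Measurable e₀)
    (he : ∀ z, Tendsto (fun n => e n z) atTop (𝓝 (e₀ z)))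
    {κ : ℕ → Measure α} {κ₀ : Measure α} [∀ n, IsProbabilityMeasure (κ n)]
    [IsProbabilityMeasure κ₀]
    (hκ : ∀ n, κ n = lam.withDensity fun z => ENNReal.ofReal (e n z))
    (hκ₀ : κ₀ = lam.withDensity fun z => ENNReal.ofReal (e₀ z))
    {F : ℕ → α → ℝ} {F₀ : α → ℝ} (hFm : ∀ n, Measurable (F n)) (hF₀m : Measurable F₀)
    (hF : ∀ z, Tendsto (fun n => F n z) atTop (𝓝 (F₀ z))) {M : ℝ} (hM : ∀ n z, |F n z| ≤ M) :
    Tendsto (fun n => ∫ z, F n z ∂(κ n)) atTop (𝓝 (∫ z, F₀ z ∂κ₀)) := by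
  have hM₀ : ∀ z, |F₀ z| ≤ M := fun z => le_of_tendsto' (hF z).abs fun n => hM n z
  have key : ∀ (G : ℕ → α → ℝ) (G₀ : α → ℝ), (∀ n, Measurable (G n)) → Measurable G₀ →
      (∀ z, Tendsto (fun n => G n z) atTop (𝓝 (G₀ z))) → (∀ n z, |G n z| ≤ M) →
      (∀ z, |G₀ z| ≤ M) → ∀ c < ∫ z, G₀ z ∂κ₀, ∀ᶠ n in atTop, c < ∫ z, G n z ∂(κ n) := by
    intro G G₀ hGm hG₀m hG hGM hG₀M c hc
    have hval : ∀ (κ : Measure α) (_ : IsProbabilityMeasure κ) (H : α → ℝ), Measurable H →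
        (∀ z, |H z| ≤ M) → 0 ≤ M + ∫ z, H z ∂κ ∧
          ∫⁻ z, ENNReal.ofReal (M + H z) ∂κ = ENNReal.ofReal (M + ∫ z, H z ∂κ) := by
      intro κ _ H hHm hHM
      have hHi := integrable_of_abs_le (π := κ) hHm hHM
      have hnn : ∀ z, 0 ≤ M + H z := fun z => by linarith [(abs_le.1 (hHM z)).1]
      have hint : ∫ z, (M + H z) ∂κ = M + ∫ z, H z ∂κ := by
        rw [integral_add (integrable_const M) hHi]; simp
      refine ⟨hint ▸ integral_nonneg hnn, ?_⟩
      have hMH : Integrable (fun z => M + H z) κ := (integrable_const M).add hHi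
      rw [← ofReal_integral_eq_lintegral_ofReal hMH (Eventually.of_forall hnn), hint]
    have hdens : ∀ (κ : Measure α) (e H : α → ℝ), Measurable e → Measurable H →
        κ = lam.withDensity (fun z => ENNReal.ofReal (e z)) →
        ∫⁻ z, ENNReal.ofReal (M + H z) ∂κ =
          ∫⁻ z, ENNReal.ofReal (e z) * ENNReal.ofReal (M + H z) ∂lam := by
      intro κ e H hem hHm hκ
      rw [hκ, lintegral_withDensity_eq_lintegral_mul _ (by fun_prop) (by fun_prop)]
      rfl
    have hfatou : ENNReal.ofReal (M + ∫ z, G₀ z ∂κ₀) ≤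
        liminf (fun n => ENNReal.ofReal (M + ∫ z, G n z ∂(κ n))) atTop := by
      rw [← (hval κ₀ inferInstance G₀ hG₀m hG₀M).2, hdens κ₀ e₀ G₀ he₀m hG₀m hκ₀]
      simp_rw [← fun n => (hval (κ n) inferInstance (G n) (hGm n) (hGM n)).2,
        fun n => hdens (κ n) (e n) (G n) (hem n) (hGm n) (hκ n)]
      refine le_trans (le_of_eq ?_) (lintegral_liminf_le fun n => by fun_prop)
      refine lintegral_congr fun z => (Tendsto.liminf_eq ?_).symm
      exact ENNReal.Tendsto.mul (ENNReal.tendsto_ofReal (he z)) (Or.inr (by simp))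
        (ENNReal.tendsto_ofReal ((hG z).const_add M)) (Or.inr (by simp))
    rcases lt_or_ge (M + c) 0 with hneg | hpos
    · refine Eventually.of_forall fun n => ?_
      have := (hval (κ n) inferInstance (G n) (hGm n) (hGM n)).1
      linarith
    · have hlt : ENNReal.ofReal (M + c) < liminf (fun n => ENNReal.ofReal (M + ∫ z, G n z ∂(κ n)))
          atTop := lt_of_lt_of_le
        ((ENNReal.ofReal_lt_ofReal_iff (by linarith)).2 (by linarith)) hfatou
      filter_upwards [eventually_lt_of_lt_liminf hlt] with n hn
      have := (ENNReal.ofReal_lt_ofReal_iff_of_nonneg hpos).1 hn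
      linarith
  refine tendsto_order.2 ⟨key F F₀ hFm hF₀m hF hM hM₀, fun c hc => ?_⟩
  have h := key (fun n z => -F n z) (fun z => -F₀ z) (fun n => (hFm n).neg) hF₀m.neg
    (fun z => (hF z).neg) (fun n z => by rw [abs_neg]; exact hM n z)
    (fun z => by rw [abs_neg]; exact hM₀ z) (-c) (by rw [integral_neg]; linarith)
  filter_upwards [h] with n hn
  rw [integral_neg] at hn
  linarith

end Feller

/-! ### Weak limits and uniform integrability -/

section WeakLimits

variable {S : Type*} [MeasurableSpace S] [TopologicalSpace S] [BorelSpace S]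
  [HasOuterApproxClosed S]
  {P : ℕ → ProbabilityMeasure S} {P₀ : ProbabilityMeasure S}

theorem lintegral_le_of_tendsto_probabilityMeasure (hP : Tendsto P atTop (𝓝 P₀)) {f : S → ℝ}
    (hf : Continuous f) {c : ℝ≥0∞} (hc : ∀ n, ∫⁻ x, ENNReal.ofReal (f x) ∂(P n : Measure S) ≤ c) :
    ∫⁻ x, ENNReal.ofReal (f x) ∂(P₀ : Measure S) ≤ c := by
  have h := lintegral_le_liminf_lintegral_of_forall_isOpen_measure_le_liminf_measure
    (μ := (P₀ : Measure S)) (μs := fun n => (P n : Measure S)) (f := fun x => max (f x) 0)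
    (by fun_prop) (fun x => le_max_right _ _)
    fun G hG => ProbabilityMeasure.le_liminf_measure_open_of_tendsto hP hG
  have hmax : ∀ x, ENNReal.ofReal (max (f x) 0) = ENNReal.ofReal (f x) := fun x => by
    rw [ENNReal.ofReal_max]; simp
  simp_rw [hmax] at h
  refine h.trans ((liminf_le_liminf (Eventually.of_forall hc)).trans ?_)
  simp

theorem integrable_and_integral_eq_of_uniformIntegrable_real (hP : Tendsto P atTop (𝓝 P₀))
    {f : S → ℝ} (hf : Continuous f)
    (hui : ∀ ε : ℝ, 0 < ε → ∃ M : ℝ, 0 ≤ M ∧ ∀ n,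
      ∫⁻ x, ENNReal.ofReal (|f x| - M) ∂(P n : Measure S) ≤ ENNReal.ofReal ε) :
    Integrable f (P₀ : Measure S) ∧
      Tendsto (fun n => ∫ x, f x ∂(P n : Measure S)) atTop (𝓝 (∫ x, f x ∂(P₀ : Measure S))) := by
  -- the truncation of `f` at level `M` differs from `f` by the positive part of `|f| - M`
  have htrunc : ∀ (Q : ProbabilityMeasure S) (M ε : ℝ), 0 ≤ M → 0 < ε →
      ∫⁻ x, ENNReal.ofReal (|f x| - M) ∂(Q : Measure S) ≤ ENNReal.ofReal ε →
      Integrable f (Q : Measure S) ∧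
        |∫ x, f x ∂(Q : Measure S) - ∫ x, max (-M) (min M (f x)) ∂(Q : Measure S)| ≤ ε := by
    intro Q M ε hM hε hQ
    set r : S → ℝ := fun x => max (|f x| - M) 0 with hr
    have hrm : Continuous r := by fun_prop
    have hr0 : ∀ x, 0 ≤ r x := fun x => le_max_right _ _
    have hmax : ∀ x, ENNReal.ofReal (r x) = ENNReal.ofReal (|f x| - M) := fun x => by
      simp only [hr]; rw [ENNReal.ofReal_max]; simp
    have hri : Integrable r (Q : Measure S) := by
      refine ⟨hrm.aestronglyMeasurable, ?_⟩
      rw [hasFiniteIntegral_iff_ofReal (Eventually.of_forall hr0)]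
      simp_rw [hmax]
      exact hQ.trans_lt ENNReal.ofReal_lt_top
    have hfi : Integrable f (Q : Measure S) := by
      refine Integrable.mono' (hri.add (integrable_const M)) hf.aestronglyMeasurable
        (Eventually.of_forall fun x => ?_)
      rw [Real.norm_eq_abs]
      have := le_max_left (|f x| - M) 0
      simp only [Pi.add_apply, hr]
      linarith
    refine ⟨hfi, ?_⟩
    have hti : Integrable (fun x => max (-M) (min M (f x))) (Q : Measure S) :=
      integrable_of_abs_le (M := M) (by fun_prop) fun x =>
        abs_le.2 ⟨le_max_left _ _, max_le (by linarith) (min_le_left _ _)⟩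
    rw [← integral_sub hfi hti]
    refine (abs_integral_le_integral_abs).trans ?_
    calc ∫ x, |f x - max (-M) (min M (f x))| ∂(Q : Measure S) ≤ ∫ x, r x ∂(Q : Measure S) := by
          refine integral_mono (hfi.sub hti).abs hri fun x => ?_
          simp only [hr]
          rcases le_total M (f x) with h | h
          · rw [min_eq_left h, max_eq_right (by linarith), abs_of_nonneg (by linarith),
              abs_of_nonneg (by linarith)]
            exact le_max_left _ _
          · rw [min_eq_right h]
            rcases le_total (-M) (f x) with h' | h'
            · rw [max_eq_right h']; simp
            · rw [max_eq_left h', abs_of_nonpos (by linarith), abs_of_nonpos (by linarith)]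
              refine le_trans (by linarith) (le_max_left _ _)
      _ ≤ ε := by
          rw [integral_eq_lintegral_of_nonneg_ae (Eventually.of_forall hr0)
            hrm.aestronglyMeasurable]
          simp_rw [hmax]
          exact ENNReal.toReal_le_of_le_ofReal hε.le hQ
  have hlim : ∀ M ε : ℝ, (∀ n, ∫⁻ x, ENNReal.ofReal (|f x| - M) ∂(P n : Measure S) ≤
      ENNReal.ofReal ε) → ∫⁻ x, ENNReal.ofReal (|f x| - M) ∂(P₀ : Measure S) ≤ ENNReal.ofReal ε :=
    fun M ε h => lintegral_le_of_tendsto_probabilityMeasure hP (by fun_prop) h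
  refine ⟨?_, ?_⟩
  · obtain ⟨M, hM, hMn⟩ := hui 1 one_pos
    exact (htrunc P₀ M 1 hM one_pos (hlim M 1 hMn)).1
  · rw [Metric.tendsto_nhds]
    intro ε hε
    obtain ⟨M, hM, hMn⟩ := hui (ε / 3) (by positivity)
    let θ : BoundedContinuousFunction S ℝ := BoundedContinuousFunction.ofNormedAddCommGroup
      (fun x => max (-M) (min M (f x))) (by fun_prop) M fun x => by
        rw [Real.norm_eq_abs]
        exact abs_le.2 ⟨le_max_left _ _, max_le (by linarith) (min_le_left _ _)⟩
    have hθ := Metric.tendsto_nhds.1 (ProbabilityMeasure.tendsto_iff_forall_integral_tendsto.1 hP θ)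
      (ε / 3) (by positivity)
    have h₀ := (htrunc P₀ M (ε / 3) hM (by positivity) (hlim M (ε / 3) hMn)).2
    filter_upwards [hθ] with n hn
    have hn' := (htrunc (P n) M (ε / 3) hM (by positivity) (hMn n)).2
    rw [Real.dist_eq] at hn ⊢
    have hn2 : |∫ x, max (-M) (min M (f x)) ∂(P n : Measure S) -
      ∫ x, max (-M) (min M (f x)) ∂(P₀ : Measure S)| < ε / 3 := hn
    rw [abs_le] at h₀ hn'
    rw [abs_lt] at hn2 ⊢
    constructor <;> linarith [h₀.1, h₀.2, hn'.1, hn'.2, hn2.1, hn2.2]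

/-- Weak convergence and uniform integrability imply convergence of means. -/
theorem integrable_and_integral_eq_of_uniformIntegrable {d : ℕ} (hP : Tendsto P atTop (𝓝 P₀))
    {f : S → Euc d} (hf : Continuous f)
    (hui : ∀ ε : ℝ, 0 < ε → ∃ M : ℝ, 0 ≤ M ∧ ∀ n,
      ∫⁻ x, ENNReal.ofReal (‖f x‖ - M) ∂(P n : Measure S) ≤ ENNReal.ofReal ε)
    (hint : ∀ n, Integrable f (P n : Measure S)) {β : Euc d}
    (hβ : Tendsto (fun n => ∫ x, f x ∂(P n : Measure S)) atTop (𝓝 β)) :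
    Integrable f (P₀ : Measure S) ∧ ∫ x, f x ∂(P₀ : Measure S) = β := by
  have h : ∀ i, Integrable (fun x => f x i) (P₀ : Measure S) ∧
      Tendsto (fun n => ∫ x, f x i ∂(P n : Measure S)) atTop
        (𝓝 (∫ x, f x i ∂(P₀ : Measure S))) := by
    intro i
    refine integrable_and_integral_eq_of_uniformIntegrable_real hP (by fun_prop) fun ε hε => ?_
    obtain ⟨M, hM, hMn⟩ := hui ε hε
    refine ⟨M, hM, fun n => (lintegral_mono fun x => ?_).trans (hMn n)⟩
    gcongr
    exact PiLp.norm_apply_le (f x) i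
  have hi₀ : Integrable f (P₀ : Measure S) := integrable_piLp_iff.2 fun i => (h i).1
  refine ⟨hi₀, ?_⟩
  ext i
  rw [eval_integral_piLp fun i => (h i).1]
  refine tendsto_nhds_unique (h i).2 ?_
  simp_rw [← fun n => eval_integral_piLp (fun i => integrable_piLp_iff.1 (hint n) i) i]
  exact ((EuclideanSpace.proj (𝕜 := ℝ) i).continuous.tendsto β).comp hβ

end WeakLimits

/-! ### Tightness -/

section Tightness

/-- Markov's inequality: uniformly bounded first moments give tightness. -/
theorem isTightMeasureSet_of_lintegral_enorm_le {E : Type*} [NormedAddCommGroup E] [ProperSpace E]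
    [MeasurableSpace E] [BorelSpace E] {𝒮 : Set (Measure E)} {R : ℝ≥0}
    (hR : ∀ μ ∈ 𝒮, ∫⁻ x, ‖x‖ₑ ∂μ ≤ R) : IsTightMeasureSet 𝒮 := by
  refine isTightMeasureSet_of_tendsto_measure_norm_gt ?_
  have hlim : Tendsto (fun r : ℝ => (R : ℝ≥0∞) / ENNReal.ofReal r) atTop (𝓝 0) := by
    have := ENNReal.Tendsto.const_div (a := (R : ℝ≥0∞)) ENNReal.tendsto_ofReal_atTop
      (Or.inr ENNReal.coe_ne_top)
    simpa using this
  refine tendsto_of_tendsto_of_tendsto_of_le_of_le' tendsto_const_nhds hlim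
    (Eventually.of_forall fun _ => zero_le) ?_
  filter_upwards [eventually_gt_atTop 0] with r hr
  refine iSup₂_le fun μ hμ => ?_
  calc μ {x | r < ‖x‖} ≤ μ {x | ENNReal.ofReal r ≤ ‖x‖ₑ} := by
        refine measure_mono fun x hx => ?_
        rw [mem_ofPred_eq, ← ofReal_norm]
        exact ENNReal.ofReal_le_ofReal (le_of_lt hx)
    _ ≤ (∫⁻ x, ‖x‖ₑ ∂μ) / ENNReal.ofReal r :=
        meas_ge_le_lintegral_div (by fun_prop) (by simpa using hr) (by simp)
    _ ≤ R / ENNReal.ofReal r := by gcongr; exact hR μ hμ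

end Tightness

/-! ### Lower semicontinuity of the local rate -/

section LowerSemicontinuity

open InformationTheory BoundedContinuousFunction

variable {d₁ d₂ : ℕ} {g : Euc d₁ → Euc d₂ → Euc d₁} {ρ : Euc d₁ → Kernel (Euc d₂) (Euc d₂)}

/-- The space of points `((x, y), (z, w))`: state, last noise, next noise, and a value in the range
of `g`. -/
abbrev AugSpace (d₁ d₂ : ℕ) : Type := (Euc d₁ × Euc d₂) × (Euc d₂ × Euc d₁)

/-- The point `((x, y), (z, g(x, z)))` attached to the state `x` and to the noise pair `(y, z)`.
Carrying `x` and `g(x, z)` as coordinates turns quantities that depend on the state, or on the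
discontinuous function `g(x, ·)`, into continuous functions. -/
def transitionPoint (g : Euc d₁ → Euc d₂ → Euc d₁) (x : Euc d₁) (p : Euc d₂ × Euc d₂) :
    AugSpace d₁ d₂ :=
  ((x, p.1), (p.2, g x p.2))

/-- The dual term `∫ (exp ψ(x, y, z, g(x, z)) - 1) ρ_x(y, dz)` as a function of `(x, y)`. -/
noncomputable def dualTerm (g : Euc d₁ → Euc d₂ → Euc d₁) (ρ : Euc d₁ → Kernel (Euc d₂) (Euc d₂))
    (ψ : AugSpace d₁ d₂ →ᵇ ℝ) (p : Euc d₁ × Euc d₂) : ℝ :=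
  ∫ z, (Real.exp (ψ (p, (z, g p.1 z))) - 1) ∂(ρ p.1 p.2)

theorem measurable_transitionPoint (hgm : ∀ x, Measurable (g x)) (x : Euc d₁) :
    Measurable (transitionPoint g x) := by
  have := hgm x
  unfold transitionPoint
  fun_prop

variable [∀ x, IsMarkovKernel (ρ x)]

theorem abs_exp_sub_one_le {S : Type*} [TopologicalSpace S] (ψ : S →ᵇ ℝ) (s : S) :
    |Real.exp (ψ s) - 1| ≤ Real.exp ‖ψ‖ + 1 := by
  have h1 : Real.exp (ψ s) ≤ Real.exp ‖ψ‖ :=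
    Real.exp_le_exp.2 ((le_abs_self _).trans (ψ.norm_coe_le_norm s))
  have h2 := Real.exp_pos (ψ s)
  rw [abs_le]
  constructor <;> linarith

theorem abs_dualTerm_le (ψ : AugSpace d₁ d₂ →ᵇ ℝ) (p : Euc d₁ × Euc d₂) :
    |dualTerm g ρ ψ p| ≤ Real.exp ‖ψ‖ + 1 := by
  have h := norm_integral_le_of_norm_le_const (μ := ρ p.1 p.2)
    (f := fun z => Real.exp (ψ (p, (z, g p.1 z))) - 1) (C := Real.exp ‖ψ‖ + 1)
    (Eventually.of_forall fun z => abs_exp_sub_one_le ψ _)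
  simpa [dualTerm] using h

/-- The Feller property of the transition `(x, y) ↦ (z, g(x, z))`. -/
theorem continuous_dualTerm {lam : Measure (Euc d₂)} {η : Euc d₁ → Euc d₂ → Euc d₂ → ℝ}
    (hgm : ∀ x, Measurable (g x)) (hgc : ∀ z, Continuous fun x => g x z)
    (hηm : ∀ x y, Measurable (η x y))
    (hηc : ∀ z, Continuous fun p : Euc d₁ × Euc d₂ => η p.1 p.2 z)
    (hρ : ∀ x y, ρ x y = lam.withDensity fun z => ENNReal.ofReal (η x y z))
    (ψ : AugSpace d₁ d₂ →ᵇ ℝ) : Continuous (dualTerm g ρ ψ) := by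
  have hmeas : ∀ p : Euc d₁ × Euc d₂,
      Measurable fun z => Real.exp (ψ (p, (z, g p.1 z))) - 1 := fun p => by
    have h1 := hgm p.1
    have h2 : Measurable fun z => ψ (p, (z, g p.1 z)) :=
      ψ.continuous.measurable.comp (by fun_prop)
    fun_prop
  refine continuous_iff_continuousAt.2 fun p => tendsto_of_seq_tendsto fun q hq => ?_
  refine tendsto_integral_withDensity (lam := lam) (e := fun n z => η (q n).1 (q n).2 z)
    (e₀ := fun z => η p.1 p.2 z) (fun n => hηm _ _) (hηm _ _)
    (fun z => ((hηc z).tendsto p).comp hq) (fun n => hρ _ _) (hρ _ _) (fun n => hmeas _)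
    (hmeas _) (fun z => ?_) (fun n z => abs_exp_sub_one_le ψ _)
  have hcont : Continuous fun p : Euc d₁ × Euc d₂ => Real.exp (ψ (p, (z, g p.1 z))) - 1 := by
    have := hgc z
    fun_prop
  exact (hcont.tendsto p).comp hq

/-- The dual inequality for the law of `(x, y, z, g(x, z))` under a coupling. -/
theorem integral_map_transitionPoint_le (hgm : ∀ x, Measurable (g x)) {x : Euc d₁}
    {μ : Measure (Euc d₂)} [IsProbabilityMeasure μ] {γ : Measure (Euc d₂ × Euc d₂)}
    (hγ : γ ∈ couplings μ) {K : ℝ} (hK0 : 0 ≤ K) (hK : klDiv γ (μ ⊗ₘ ρ x) ≤ ENNReal.ofReal K)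
    (ψ : AugSpace d₁ d₂ →ᵇ ℝ) (hψ : Continuous (dualTerm g ρ ψ)) :
    ∫ q, ψ q ∂(γ.map (transitionPoint g x)) ≤
      K + ∫ q, dualTerm g ρ ψ q.1 ∂(γ.map (transitionPoint g x)) := by
  have hp := hγ.1
  have hJ := measurable_transitionPoint hgm x
  have hψm : Measurable fun p => ψ (transitionPoint g x p) := ψ.continuous.measurable.comp hJ
  rw [integral_map hJ.aemeasurable ψ.continuous.aestronglyMeasurable,
    integral_map hJ.aemeasurable
      (Continuous.aestronglyMeasurable (f := fun q => dualTerm g ρ ψ q.1) (by fun_prop))]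
  have h1 := integral_le_klDiv_add (ne_top_of_le_ne_top ENNReal.ofReal_ne_top hK) hψm
    (M := ‖ψ‖) fun p => ψ.norm_coe_le_norm _
  have h2 : (klDiv γ (μ ⊗ₘ ρ x)).toReal ≤ K := ENNReal.toReal_le_of_le_ofReal hK0 hK
  have h3 : ∫ p, (Real.exp (ψ (transitionPoint g x p)) - 1) ∂(μ ⊗ₘ ρ x) =
      ∫ p, dualTerm g ρ ψ (transitionPoint g x p).1 ∂γ := by
    rw [Measure.integral_compProd (integrable_exp_sub_one_of_abs_le hψm
      fun p => ψ.norm_coe_le_norm _)]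
    change ∫ y, dualTerm g ρ ψ (x, y) ∂μ = _
    rw [← hγ.2.1, Measure.fst, integral_map measurable_fst.aemeasurable
      (Continuous.aestronglyMeasurable (f := fun y => dualTerm g ρ ψ (x, y)) (by fun_prop))]
    rfl
  linarith

/-- A law of `((x, y), (z, w))` that satisfies the dual inequality is carried by the graph
`w = g(x, z)`, and its `(y, z)`-marginal is a coupling with controlled relative entropy. -/
theorem klDiv_le_of_dual (hgm : ∀ x, Measurable (g x)) {x : Euc d₁}
    {π : Measure (AugSpace d₁ d₂)} [IsProbabilityMeasure π]
    {K : ℝ} (hdual : ∀ ψ, ∫ q, ψ q ∂π ≤ K + ∫ q, dualTerm g ρ ψ q.1 ∂π)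
    (hcont : ∀ ψ, Continuous (dualTerm g ρ ψ))
    (hx : ∀ᵐ q ∂π, q.1.1 = x) :
    klDiv (π.map fun q => (q.1.2, q.2.1)) ((π.map fun q => q.1.2) ⊗ₘ ρ x) ≤ ENNReal.ofReal K ∧
      ∀ᵐ q ∂π, q.2.2 = g x q.2.1 := by
  set μ := π.map fun q => q.1.2 with hμ
  have hμp : IsProbabilityMeasure μ := Measure.isProbabilityMeasure_map (by fun_prop)
  have hγp : IsProbabilityMeasure (π.map fun q => (q.1.2, q.2.1)) :=
    Measure.isProbabilityMeasure_map (by fun_prop)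
  have hJ := measurable_transitionPoint hgm x
  have hterm : ∀ ψ, ∫ q, dualTerm g ρ ψ q.1 ∂π =
      ∫ p, (Real.exp (ψ (transitionPoint g x p)) - 1) ∂(μ ⊗ₘ ρ x) := by
    intro ψ
    have hψm : Measurable fun p => ψ (transitionPoint g x p) := ψ.continuous.measurable.comp hJ
    have hc := hcont ψ
    rw [Measure.integral_compProd (integrable_exp_sub_one_of_abs_le hψm
      fun p => ψ.norm_coe_le_norm _)]
    change _ = ∫ y, dualTerm g ρ ψ (x, y) ∂μ
    rw [hμ, integral_map (by fun_prop)
      (Continuous.aestronglyMeasurable (f := fun y => dualTerm g ρ ψ (x, y)) (by fun_prop))]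
    refine integral_congr_ae ?_
    filter_upwards [hx] with q hq
    rw [← hq]
  constructor
  · refine (klDiv_le_of_forall_boundedContinuous fun φ => ?_).2
    let ψ : AugSpace d₁ d₂ →ᵇ ℝ :=
      φ.compContinuous ⟨fun q => (q.1.2, q.2.1), by fun_prop⟩
    rw [integral_map (by fun_prop) φ.continuous.aestronglyMeasurable]
    have h := hdual ψ
    rw [hterm ψ] at h
    exact h
  · have hac : π ≪ (μ ⊗ₘ ρ x).map (transitionPoint g x) := by
      have : IsProbabilityMeasure ((μ ⊗ₘ ρ x).map (transitionPoint g x)) :=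
        Measure.isProbabilityMeasure_map hJ.aemeasurable
      refine (klDiv_le_of_forall_boundedContinuous (c := K) fun ψ => ?_).1
      have h := hdual ψ
      rw [hterm ψ] at h
      rwa [integral_map hJ.aemeasurable (Continuous.aestronglyMeasurable (by fun_prop))]
    refine hac.ae_le ?_
    have hgx := hgm x
    have hset : MeasurableSet {q : AugSpace d₁ d₂ | q.2.2 = g x q.2.1} :=
      measurableSet_eq_fun (by fun_prop) (by fun_prop)
    exact (ae_map_iff hJ.aemeasurable hset).2 (Eventually.of_forall fun p => rfl)

/-- The local rate is jointly lower semicontinuous. Along a convergent sequence with bounded rates,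
near-optimal couplings give laws of `((x, y), (z, g(x, z)))` that are tight; any limit law satisfies
the limiting dual inequality, hence comes from a coupling for the limiting state, and its mean is
the limiting velocity by uniform integrability. -/
theorem lowerSemicontinuous_localRate {lam : Measure (Euc d₂)} {η : Euc d₁ → Euc d₂ → Euc d₂ → ℝ}
    (hgm : ∀ x, Measurable (g x)) (hgc : ∀ z, Continuous fun x => g x z)
    (hηm : ∀ x y, Measurable (η x y))
    (hηc : ∀ z, Continuous fun p : Euc d₁ × Euc d₂ => η p.1 p.2 z)
    (hρ : ∀ x y, ρ x y = lam.withDensity fun z => ENNReal.ofReal (η x y z))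
    (hg : ∀ c : ℝ≥0, ∃ C : ℝ≥0, ∀ x y, ∫⁻ z, ENNReal.ofReal (Real.exp (c * ‖g x z‖)) ∂(ρ x y) ≤ C)
    (hz : ∀ c : ℝ≥0, ∃ C : ℝ≥0, ∀ x y, ∫⁻ z, ENNReal.ofReal (Real.exp (c * ‖z‖)) ∂(ρ x y) ≤ C) :
    LowerSemicontinuous fun p : Euc d₁ × Euc d₁ => localRate g ρ p.1 p.2 := by
  have hcont : ∀ ψ, Continuous (dualTerm g ρ ψ) := continuous_dualTerm hgm hgc hηm hηc hρ
  refine lowerSemicontinuous_iff_isClosed_preimage.2 fun c => ?_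
  induction c with
  | top => simp
  | coe c =>
  refine IsSeqClosed.isClosed fun p p₀ hp hlim => ?_
  obtain ⟨x, β⟩ := p₀
  have hxlim : Tendsto (fun n => (p n).1) atTop (𝓝 x) := hlim.fst_nhds
  have hβlim : Tendsto (fun n => (p n).2) atTop (𝓝 β) := hlim.snd_nhds
  have hlt : ∀ n, localRate g ρ (p n).1 (p n).2 < ENNReal.ofReal (c + 1 / ((n : ℝ) + 1)) := by
    intro n
    have hpn : localRate g ρ (p n).1 (p n).2 ≤ c := hp n
    refine hpn.trans_lt ?_
    rw [← ENNReal.ofReal_coe_nnreal]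
    have : (0 : ℝ) < 1 / ((n : ℝ) + 1) := by positivity
    exact (ENNReal.ofReal_lt_ofReal_iff (by positivity)).2 (by linarith)
  choose μ γ hμ hint hβ hγ hkl using fun n => exists_coupling_of_localRate_lt (hlt n)
  have hγp : ∀ n, IsProbabilityMeasure (γ n) := fun n => (hγ n).1
  have hkl1 : ∀ n, klDiv (γ n) (μ n ⊗ₘ ρ (p n).1) ≤ (c + 1 : ℝ≥0) := by
    intro n
    refine (hkl n).le.trans (ENNReal.ofReal_le_of_le_toReal ?_)
    have h1 : (1 : ℝ) / ((n : ℝ) + 1) ≤ 1 := by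
      rw [div_le_one (by positivity)]; linarith [n.cast_nonneg (α := ℝ)]
    rw [ENNReal.coe_toReal, NNReal.coe_add, NNReal.coe_one]
    linarith
  have hJ : ∀ n, Measurable (transitionPoint g (p n).1) := fun n =>
    measurable_transitionPoint hgm _
  let P : ℕ → ProbabilityMeasure (AugSpace d₁ d₂) := fun n =>
    ⟨(γ n).map (transitionPoint g (p n).1), Measure.isProbabilityMeasure_map (hJ n).aemeasurable⟩
  have hPv : ∀ n, (P n : Measure _) = (γ n).map (transitionPoint g (p n).1) := fun n => rfl
  have hPlint : ∀ n {f : AugSpace d₁ d₂ → ℝ≥0∞}, Measurable f →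
      ∫⁻ q, f q ∂(P n : Measure _) = ∫⁻ r, f (transitionPoint g (p n).1 r) ∂(γ n) :=
    fun n f hf => lintegral_map hf (hJ n)
  -- tightness
  have htight : IsTightMeasureSet
      {ν | ∃ Q ∈ range P, (Q : Measure (AugSpace d₁ d₂)) = ν} := by
    obtain ⟨C₁, hC₁⟩ := hg 1
    obtain ⟨C₂, hC₂⟩ := hz 1
    obtain ⟨B, hB⟩ := hxlim.norm.bddAbove_range
    refine isTightMeasureSet_of_lintegral_enorm_le
      (R := B.toNNReal + ((c + 1) + C₂) + (((c + 1) + C₂) + ((c + 1) + C₁))) ?_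
    rintro _ ⟨_, ⟨n, rfl⟩, rfl⟩
    have hy : ∫⁻ y, ‖y‖ₑ ∂(μ n) ≤ ((c + 1) + C₂ : ℝ≥0) := by
      have h := lintegral_ofReal_norm_le (hγ n) measurable_id (c := 1)
        (C := C₂) fun y => by simpa using hC₂ (p n).1 y
      simp only [one_mul, ofReal_norm, id] at h
      exact h.trans (by rw [ENNReal.coe_add]; gcongr; exact hkl1 n)
    have hw : ∫⁻ y, ‖g (p n).1 y‖ₑ ∂(μ n) ≤ ((c + 1) + C₁ : ℝ≥0) := by
      have h := lintegral_ofReal_norm_le (hγ n) (hgm (p n).1) (c := 1)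
        (C := C₁) fun y => by simpa using hC₁ (p n).1 y
      simp only [one_mul, ofReal_norm] at h
      exact h.trans (by rw [ENNReal.coe_add]; gcongr; exact hkl1 n)
    have hgx := hgm (p n).1
    rw [hPlint n (by fun_prop)]
    calc ∫⁻ r, ‖transitionPoint g (p n).1 r‖ₑ ∂(γ n)
        ≤ ∫⁻ r, ((B.toNNReal + ‖r.1‖ₑ) + (‖r.2‖ₑ + ‖g (p n).1 r.2‖ₑ)) ∂(γ n) := by
          refine lintegral_mono fun r => ?_
          have hxB : ‖(p n).1‖ₑ ≤ B.toNNReal := by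
            rw [← ofReal_norm]
            exact ENNReal.ofReal_le_ofReal (hB ⟨n, rfl⟩)
          simp only [transitionPoint, enorm_eq_nnnorm, Prod.nnnorm_mk, ENNReal.coe_max] at hxB ⊢
          refine max_le ((max_le ?_ ?_).trans le_self_add) ((max_le ?_ ?_).trans le_add_self)
          · exact hxB.trans le_self_add
          · exact le_add_self
          · exact le_self_add
          · exact le_add_self
      _ = (B.toNNReal + ∫⁻ y, ‖y‖ₑ ∂(μ n)) + (∫⁻ y, ‖y‖ₑ ∂(μ n) + ∫⁻ y, ‖g (p n).1 y‖ₑ ∂(μ n)) := by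
          rw [lintegral_add_left (by fun_prop), lintegral_add_left (by fun_prop),
            lintegral_add_left (by fun_prop),
            lintegral_fst_of_mem_couplings (hγ n) (f := fun y => ‖y‖ₑ) (by fun_prop),
            lintegral_snd_of_mem_couplings (hγ n) (f := fun y => ‖y‖ₑ) (by fun_prop),
            lintegral_snd_of_mem_couplings (hγ n) (f := fun y => ‖g (p n).1 y‖ₑ) (by fun_prop)]
          simp
      _ ≤ _ := by
          rw [ENNReal.coe_add, ENNReal.coe_add (B.toNNReal), ENNReal.coe_add ((c + 1) + C₂)]
          gcongr
  obtain ⟨π, -, s, hs, hPlim⟩ := (isCompact_closure_of_isTightMeasureSet htight).tendsto_subseq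
    fun n => subset_closure (mem_range_self n)
  have hPint := ProbabilityMeasure.tendsto_iff_forall_integral_tendsto.1 hPlim
  -- the dual inequality passes to the limit
  have hdual : ∀ ψ, ∫ q, ψ q ∂(π : Measure (AugSpace d₁ d₂)) ≤
      c + ∫ q, dualTerm g ρ ψ q.1 ∂(π : Measure (AugSpace d₁ d₂)) := by
    intro ψ
    have hc := hcont ψ
    let θ : AugSpace d₁ d₂ →ᵇ ℝ :=
      BoundedContinuousFunction.ofNormedAddCommGroup (fun q => dualTerm g ρ ψ q.1) (by fun_prop)
        (Real.exp ‖ψ‖ + 1) fun q => abs_dualTerm_le ψ q.1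
    have h1 : Tendsto (fun n : ℕ => (c : ℝ) + 1 / (((s n : ℕ) : ℝ) + 1)) atTop (𝓝 (c + 0)) :=
      (tendsto_one_div_add_atTop_nhds_zero_nat.comp hs.tendsto_atTop).const_add _
    rw [add_zero] at h1
    refine le_of_tendsto_of_tendsto' (hPint ψ) (h1.add (hPint θ)) fun n => ?_
    exact integral_map_transitionPoint_le hgm (hγ _) (by positivity) (hkl _).le ψ hc
  have hπx : ∀ᵐ q ∂(π : Measure (AugSpace d₁ d₂)), q.1.1 = x := by
    let θ : AugSpace d₁ d₂ →ᵇ ℝ :=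
      BoundedContinuousFunction.ofNormedAddCommGroup (fun q => min (dist q.1.1 x) 1)
        (by fun_prop) 1 fun q => by
          rw [Real.norm_of_nonneg (le_min dist_nonneg zero_le_one)]
          exact min_le_right _ _
    have hθ : ∀ q, θ q = min (dist q.1.1 x) 1 := fun q => rfl
    have h1 : Tendsto (fun n => min (dist (p (s n)).1 x) 1) atTop (𝓝 0) := by
      have := ((tendsto_iff_dist_tendsto_zero.1 hxlim).comp hs.tendsto_atTop).min
        (tendsto_const_nhds (x := (1 : ℝ)))
      simpa using this
    have h2 : ∫ q, θ q ∂(π : Measure (AugSpace d₁ d₂)) = 0 := by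
      refine tendsto_nhds_unique (hPint θ) (h1.congr fun n => ?_)
      simp only [Function.comp_apply]
      rw [hPv, integral_map (hJ _).aemeasurable θ.continuous.aestronglyMeasurable]
      simp [hθ, transitionPoint]
    have h3 := (integral_eq_zero_iff_of_nonneg
      (fun q => by rw [hθ]; exact le_min dist_nonneg zero_le_one) (θ.integrable _)).1 h2
    filter_upwards [h3] with q hq
    rw [hθ, Pi.zero_apply] at hq
    rcases min_choice (dist q.1.1 x) 1 with h | h
    · exact dist_eq_zero.1 (h ▸ hq)
    · rw [h] at hq; exact absurd hq one_ne_zero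
  obtain ⟨hle, hgraph⟩ := klDiv_le_of_dual hgm hdual hcont hπx
  -- both noise marginals agree along the sequence, hence in the limit
  have hmarg : (π : Measure (AugSpace d₁ d₂)).map (fun q => q.1.2) =
      (π : Measure (AugSpace d₁ d₂)).map fun q => q.2.1 := by
    have : IsProbabilityMeasure ((π : Measure (AugSpace d₁ d₂)).map
      fun q => q.1.2) := Measure.isProbabilityMeasure_map (by fun_prop)
    have : IsProbabilityMeasure ((π : Measure (AugSpace d₁ d₂)).map
      fun q => q.2.1) := Measure.isProbabilityMeasure_map (by fun_prop)
    refine ext_of_forall_integral_eq_of_IsFiniteMeasure fun φ => ?_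
    rw [integral_map (by fun_prop) φ.continuous.aestronglyMeasurable,
      integral_map (by fun_prop) φ.continuous.aestronglyMeasurable]
    refine tendsto_nhds_unique (hPint (φ.compContinuous ⟨fun q => q.1.2, by fun_prop⟩))
      ((hPint (φ.compContinuous ⟨fun q => q.2.1, by fun_prop⟩)).congr fun n => ?_)
    simp only [Function.comp_apply, compContinuous_apply, ContinuousMap.coe_mk]
    rw [hPv, integral_map (hJ _).aemeasurable (Continuous.aestronglyMeasurable (by fun_prop)),
      integral_map (hJ _).aemeasurable (Continuous.aestronglyMeasurable (by fun_prop))]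
    simp only [transitionPoint]
    have h1 := integral_map (μ := γ (s n)) measurable_fst.aemeasurable
      φ.continuous.aestronglyMeasurable
    have h2 := integral_map (μ := γ (s n)) measurable_snd.aemeasurable
      φ.continuous.aestronglyMeasurable
    rw [← h1, ← h2]
    exact congrArg (fun ν => ∫ y, φ y ∂ν) ((hγ (s n)).2.2.trans (hγ (s n)).2.1.symm)
  -- convergence of the means
  have hmean := integrable_and_integral_eq_of_uniformIntegrable (β := β) hPlim
    (f := fun q : AugSpace d₁ d₂ => q.2.2) (by fun_prop) ?_ ?_ ?_
  · have hcoup : (π : Measure (AugSpace d₁ d₂)).map (fun q => (q.1.2, q.2.1)) ∈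
        couplings ((π : Measure (AugSpace d₁ d₂)).map fun q => q.1.2) :=
      ⟨Measure.isProbabilityMeasure_map (by fun_prop), Measure.fst_map_prodMk (by fun_prop),
        (Measure.snd_map_prodMk (by fun_prop)).trans hmarg.symm⟩
    have hgx := hgm x
    have hint' : Integrable (fun q => g x q.2.1) (π : Measure (AugSpace d₁ d₂)) :=
      hmean.1.congr hgraph
    refine (localRate_le (Measure.isProbabilityMeasure_map (by fun_prop)) ?_ ?_ hcoup).trans
      (hle.trans (by simp))
    · rw [hmarg, integrable_map_measure hgx.aestronglyMeasurable (by fun_prop)]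
      exact hint'
    · rw [hmarg, integral_map (by fun_prop) hgx.aestronglyMeasurable, ← hmean.2]
      exact integral_congr_ae hgraph
  · -- uniform integrability from the exponential moments of `g`
    intro ε hε
    -- by Young's inequality, `a` times the excess of `‖g‖` over `M` has integral at most the
    -- entropy plus `1`, once `M` makes the exponential integral at most `1`
    set a : ℝ≥0 := ((c + 2) / ε.toNNReal) with ha
    have hεN : 0 < ε.toNNReal := Real.toNNReal_pos.2 hε
    have ha0 : 0 < a := by positivity
    obtain ⟨C, hC⟩ := hg a
    set M : ℝ := Real.log (C + 1) / a with hM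
    have hM0 : 0 ≤ M := div_nonneg (Real.log_nonneg (by simp)) ha0.le
    refine ⟨M, hM0, fun n => ?_⟩
    have hgx := hgm (p (s n)).1
    simp only [Function.comp_apply]
    rw [hPlint _ (by fun_prop)]
    simp only [transitionPoint]
    rw [lintegral_snd_of_mem_couplings (hγ _)
      (f := fun z => ENNReal.ofReal (‖g (p (s n)).1 z‖ - M)) (by fun_prop)]
    have hexp : ∀ y, ∫⁻ z, ENNReal.ofReal (Real.exp (a * (‖g (p (s n)).1 z‖ - M)) - 1)
        ∂(ρ (p (s n)).1 y) ≤ 1 := by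
      intro y
      have haM : (a : ℝ) * M = Real.log (C + 1) := by rw [hM]; field_simp
      calc ∫⁻ z, ENNReal.ofReal (Real.exp (a * (‖g (p (s n)).1 z‖ - M)) - 1) ∂(ρ (p (s n)).1 y)
          ≤ ∫⁻ z, ENNReal.ofReal ((C + 1 : ℝ)⁻¹) *
              ENNReal.ofReal (Real.exp (a * ‖g (p (s n)).1 z‖)) ∂(ρ (p (s n)).1 y) := by
            refine lintegral_mono fun z => ?_
            rw [← ENNReal.ofReal_mul (by positivity)]
            refine ENNReal.ofReal_le_ofReal ((sub_le_self _ zero_le_one).trans (le_of_eq ?_))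
            rw [mul_sub, haM, Real.exp_sub, Real.exp_log (by positivity), div_eq_inv_mul]
        _ ≤ ENNReal.ofReal ((C + 1 : ℝ)⁻¹) * C := by
            rw [lintegral_const_mul _ (by fun_prop)]
            gcongr
            exact hC _ y
        _ ≤ 1 := by
            rw [← ENNReal.ofReal_coe_nnreal, ← ENNReal.ofReal_mul (by positivity),
              ENNReal.ofReal_le_one, inv_mul_le_iff₀ (by positivity)]
            simp
    have h1 := lintegral_ofReal_le_klDiv_add_of_mem_couplings (hγ (s n))
      (ψ := fun z => a * (‖g (p (s n)).1 z‖ - M)) (by fun_prop) hexp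
    have h2 : (a : ℝ≥0∞) * ∫⁻ z, ENNReal.ofReal (‖g (p (s n)).1 z‖ - M) ∂(μ (s n)) ≤
        a * ENNReal.ofReal ε := by
      rw [← lintegral_const_mul _ (by fun_prop)]
      simp_rw [ENNReal.ofReal_mul a.coe_nonneg, ENNReal.ofReal_coe_nnreal] at h1
      refine h1.trans ((add_le_add_left (hkl1 _) 1).trans ?_)
      have h3 : (a : ℝ≥0∞) * ENNReal.ofReal ε = ((c + 2 : ℝ≥0) : ℝ≥0∞) := by
        rw [ENNReal.ofReal, ← ENNReal.coe_mul, ha, div_mul_cancel₀ _ hεN.ne']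
      rw [h3, ← ENNReal.coe_one, ← ENNReal.coe_add, ENNReal.coe_le_coe]
      exact le_of_eq (by ring)
    exact (ENNReal.mul_le_mul_iff_right (by simpa using ha0.ne') ENNReal.coe_ne_top).1 h2
  · intro n
    have hgx := hgm (p (s n)).1
    simp only [Function.comp_apply]
    rw [hPv, integrable_map_measure (Continuous.aestronglyMeasurable (by fun_prop))
      (hJ _).aemeasurable]
    have h1 := hint (s n)
    rw [← (hγ (s n)).2.2, Measure.snd, integrable_map_measure hgx.aestronglyMeasurable
      measurable_snd.aemeasurable] at h1
    exact h1
  · refine (hβlim.comp hs.tendsto_atTop).congr fun n => ?_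
    have hgx := hgm (p (s n)).1
    simp only [Function.comp_apply]
    rw [hPv, integral_map (hJ _).aemeasurable (Continuous.aestronglyMeasurable (by fun_prop)),
      hβ (s n)]
    nth_rewrite 1 [← (hγ (s n)).2.2]
    rw [Measure.snd, integral_map measurable_snd.aemeasurable hgx.aestronglyMeasurable]
    rfl

end LowerSemicontinuity

end StochApprox

theorem lemmaA1 {d₁ d₂ : ℕ} (g : StochApprox.Euc d₁ → StochApprox.Euc d₂ → StochApprox.Euc d₁)
    (ρ : StochApprox.Euc d₁ → ProbabilityTheory.Kernel (StochApprox.Euc d₂) (StochApprox.Euc d₂))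
    (lam : MeasureTheory.Measure (StochApprox.Euc d₂))
    (η : StochApprox.Euc d₁ → StochApprox.Euc d₂ → StochApprox.Euc d₂ → ℝ)
    (ε : ℕ → ℝ) (T : ℝ) (hT : 0 < T) (h : ℝ → ℝ) (x₀ : StochApprox.Euc d₁)
    (hA : StochApprox.Assumptions g ρ lam η ε T h) :
    StochApprox.IsRateFunction (StochApprox.rateFn g ρ h hT x₀) := by
  have hmk : ∀ x, IsMarkovKernel (ρ x) := hA.isMarkovKernel
  have hgm : ∀ x, Measurable (g x) := fun x => hA.measurable_g.comp measurable_prodMk_left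
  have hgc : ∀ z, Continuous fun x => g x z := fun z => by
    obtain ⟨K, hK⟩ := hA.lipschitz_g z
    exact hK.continuous
  have hηm : ∀ x y, Measurable (η x y) := fun x y =>
    ((hA.density_continuous x).comp (Continuous.prodMk_right y)).measurable
  have hηc : ∀ z, Continuous fun p : StochApprox.Euc d₁ × StochApprox.Euc d₂ => η p.1 p.2 z := by
    intro z
    refine continuous_iff_continuousAt.2 fun p => Metric.continuousAt_iff'.2 fun δ hδ => ?_
    have h1 := Metric.equicontinuousAt_iff_right.1 (hA.density_equicontinuous p.1) (δ / 2)
      (by positivity)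
    have h2 := Metric.tendsto_nhds.1 (((hA.density_continuous p.1).comp
      (Continuous.prodMk_left z)).tendsto p.2) (δ / 2) (by positivity)
    filter_upwards [continuous_fst.continuousAt.eventually h1,
      continuous_snd.continuousAt.eventually h2] with q hq1 hq2
    have h3 := hq1 (q.2, z)
    simp only [Function.comp_apply] at hq2 h3
    have h4 := dist_triangle (η q.1 q.2 z) (η p.1 q.2 z) (η p.1 p.2 z)
    rw [dist_comm] at h3
    linarith
  have hg : ∀ c : ℝ≥0, ∃ C : ℝ≥0, ∀ x y,
      ∫⁻ z, ENNReal.ofReal (Real.exp (c * ‖g x z‖)) ∂(ρ x y) ≤ C := fun c => by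
    obtain ⟨C, hC⟩ := StochApprox.exists_lintegral_exp_norm_le
      (κ := fun p : StochApprox.Euc d₁ × StochApprox.Euc d₂ => ρ p.1 p.2)
      (v := fun p z => g p.1 z) (fun p => hgm p.1)
      (fun u => StochApprox.exists_lintegral_exp_inner_le (κ := fun x y => ρ x y) (v := g)
        (hA.exp_moments_g u)) c
    exact ⟨C, fun x y => hC (x, y)⟩
  have hz : ∀ c : ℝ≥0, ∃ C : ℝ≥0, ∀ x y,
      ∫⁻ z, ENNReal.ofReal (Real.exp (c * ‖z‖)) ∂(ρ x y) ≤ C := fun c => by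
    obtain ⟨C, hC⟩ := StochApprox.exists_lintegral_exp_norm_le
      (κ := fun p : StochApprox.Euc d₁ × StochApprox.Euc d₂ => ρ p.1 p.2)
      (v := fun _ z => z) (fun _ => measurable_id)
      (fun u => StochApprox.exists_lintegral_exp_inner_le (κ := fun x y => ρ x y)
        (v := fun _ z => z) (hA.exp_moments_noise u)) c
    exact ⟨C, fun x y => hC (x, y)⟩
  obtain ⟨B, hB⟩ := StochApprox.exists_timeScale_le hA.step_sum hA.stepRate_tendsto
  exact StochApprox.isRateFunction_of_isCompact fun K =>
    StochApprox.isCompact_setOf_actionFn_le (L := StochApprox.localRate g ρ) hT x₀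
      (StochApprox.lowerSemicontinuous_localRate hgm hgc hηm hηc hA.kernel_eq hg hz)
      StochApprox.localRate_convex (StochApprox.localRate_superlinear hgm hg) hB
      (StochApprox.aemeasurable_timeScale hA.step_sum hA.stepRate_tendsto) K
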